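/- Let $D>0$, $L\ge 2D$, $\lambda>0$, $G>0$, $P>0$. Place $N$ transmit nodes $t_1,\dots,t_N$ and $N$ receive nodes $r_1,\dots,r_N$ independently, the $t_k$ uniformly on the square $C_T=[0,D]\times[0,D]$ and the $r_i$ uniformly on $C_R=[L,L+D]\times[0,D]$ (two horizontally aligned squares of side length $D$ whose centers are at distance $L$). With $d_{ik}=\|r_i-t_k\|$, let $H\in\mathbb{C}^{N\times N}$ be the line-of-sight channel matrix $H_{ik}=\frac{\sqrt G}{d_{ik}}\exp\left(-j\frac{2\pi}{\lambda}d_{ik}\right)$. For given node positions consider the cooperative MIMO channel without external interference ($W=0$), $Y=HX+Z$, where $Z\sim\mathcal{CN}(0,I)$ is independent of $X$ and each transmit node has power constraint $P$, and let $$C(H)=\sup\{\,I(X;Y) : \mathbb{E}|X_k|^2\le P \text{ for all } k\,\}$$ be its capacity in bits per channel use. With all logarithms to base $2$ and $(x)^+=\max\{x,0\}$, put $$M=\max\left\{1,\ \frac{D^2}{\lambda L}\left(1+\left(\log\frac{D^2}{\lambda L}\right)^+\right)^{-1}\right\}.$$ Then there are positive constants $K_3',K_4'$, independent of $N,D,L,\lambda,G,P$,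 such that $$C(H)\ \ge\ K_3'\,\min\{N,M\}\,\log\left(1+K_4'\,\frac{GP}{L^2}\,N\right)$$ with high probability as $N\to\infty$: for all choices of $D,L,\lambda,G,P$ as functions of $N$ that satisfy the above conditions for every $N$, the probability over the node positions that the inequality holds tends to $1$ as $N\to\infty$. -/

import Mathlib

open MeasureTheory Filter
open scoped ENNReal Topology

namespace ClusterMIMO

noncomputable section

/-- The Euclidean plane. -/
abbrev Plane : Type := EuclideanSpace ℝ (Fin 2)

/-- The axis-parallel closed square of side length `D` with bottom left corner `(a, 0)`. -/
def square (a D : ℝ) : Set Plane :=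
  {p | p 0 ∈ Set.Icc a (a + D) ∧ p 1 ∈ Set.Icc 0 D}

/-- The uniform distribution on `square a D`. -/
def uniformSquare (a D : ℝ) : Measure Plane :=
  ProbabilityTheory.cond volume (square a D)

/-- The joint law of the node positions `(t, r)`: the `N` transmit nodes `t` are independent and
uniform on the square `C_T = [0, D] × [0, D]`, the `N` receive nodes `r` are independent and
uniform on `C_R = [L, L + D] × [0, D]`, and the two families are independent. The squares are
horizontally aligned and their centers are at distance `L`. -/
def nodeLaw (N : ℕ) (D L : ℝ) : Measure ((Fin N → Plane) × (Fin N → Plane)) :=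
  (Measure.pi fun _ : Fin N => uniformSquare 0 D).prod
    (Measure.pi fun _ : Fin N => uniformSquare L D)

/-- The line-of-sight channel matrix: the gain from the transmit node `k` to the receive node `i`
is `(√G / d) exp(-j (2π/λ) d)`, where `d` is the distance between the two nodes. -/
def channelMatrix {N : ℕ} (G lam : ℝ) (t r : Fin N → Plane) : Matrix (Fin N) (Fin N) ℂ :=
  Matrix.of fun i k =>
    ((√G / dist (r i) (t k) : ℝ) : ℂ) *
      Complex.exp (-Complex.I * ((2 * Real.pi / lam * dist (r i) (t k) : ℝ) : ℂ))

/-- The circularly symmetric complex Gaussian law `CN(0, 1)`: independent real and imaginary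
parts, each a centered real Gaussian of variance `1/2`. -/
def complexGaussian : Measure ℂ :=
  ((ProbabilityTheory.gaussianReal 0 (1 / 2)).prod
    (ProbabilityTheory.gaussianReal 0 (1 / 2))).map fun p : ℝ × ℝ => (⟨p.1, p.2⟩ : ℂ)

/-- The law `CN(0, I)` of the noise vector. -/
def noiseLaw (N : ℕ) : Measure (Fin N → ℂ) :=
  Measure.pi fun _ : Fin N => complexGaussian

/-- The joint law of the input `X` and the output `Y = H X + Z` (no external interference), where
`X` has law `p` and `Z` is a noise vector `CN(0, I)` independent of `X`. -/
def jointLaw {N : ℕ} (H : Matrix (Fin N) (Fin N) ℂ) (p : Measure (Fin N → ℂ)) :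
    Measure ((Fin N → ℂ) × (Fin N → ℂ)) :=
  (p.prod (noiseLaw N)).map fun q => (q.1, H.mulVec q.1 + q.2)

/-- The mutual information, in bits, of the two coordinates of a pair with joint law `ρ`: the
Kullback-Leibler divergence from the product of the marginals. -/
def mutualInfo {α β : Type*} [MeasurableSpace α] [MeasurableSpace β] (ρ : Measure (α × β)) :
    ℝ≥0∞ :=
  InformationTheory.klDiv ρ (ρ.fst.prod ρ.snd) / ENNReal.ofReal (Real.log 2)

/-- The input laws that meet the power constraint `E |X_k|² ≤ P` at each transmit node `k`. -/
def IsAdmissibleInput {N : ℕ} (P : ℝ) (p : Measure (Fin N → ℂ)) : Prop :=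
  IsProbabilityMeasure p ∧ ∀ k, ∫⁻ x, ‖x k‖ₑ ^ 2 ∂p ≤ ENNReal.ofReal P

/-- The capacity `C(H)`, in bits per channel use, of the channel `Y = H X + Z` with power
constraint `P` at each transmit node: the supremum of `I(X; Y)` over the admissible inputs. -/
def capacity {N : ℕ} (P : ℝ) (H : Matrix (Fin N) (Fin N) ℂ) : ℝ≥0∞ :=
  ⨆ (p : Measure (Fin N → ℂ)) (_ : IsAdmissibleInput P p), mutualInfo (jointLaw H p)

/-- `M = max {1, x / (1 + (log₂ x)⁺)}` with `x = D² / (λ L)`. -/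
def dof (D L lam : ℝ) : ℝ :=
  max 1 (D ^ 2 / (lam * L) / (1 + max (Real.logb 2 (D ^ 2 / (lam * L))) 0))

end

end ClusterMIMO

namespace ClusterMIMO

/-! For a fixed channel matrix, feed i.i.d. complex Gaussians of power `P` rotated by a unitary `V`
that diagonalises `Hᴴ H`. The channel splits into parallel scalar channels, so the capacity is at
least the sum of `log (1 + P μ_j)` over any set of positive eigenvalues `μ_j` of `Hᴴ H`
(`sum_logb_le_capacity`). No differential entropy is computed: the information density is inserted
as a test function into the variational lower bound for the divergence.

A Paley–Zygmund count then shows that at least `(tr Hᴴ H)² / (4 tr (Hᴴ H)²)` eigenvalues are at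
least half their mean (`trace_bound_le_capacity`). The geometry bounds the trace below
deterministically by a multiple of `G N² / L²`. It remains to bound the fourth Schatten moment `tr
(Hᴴ H)²` above by a multiple of `(G / L²)² N⁴ / min {N, M}` with high probability.

Normalise the entries to a kernel `h r t` bounded by 2. Given the receivers, the fourth moment is a
double sum over transmitters whose conditional mean is a double sum over receivers of squared
averaged row correlations. Two applications of a variance bound for U-statistics and Chebyshev's
inequality give `tr = O(N² (N + N² ε))` outside an event of probability `O(1 / N)`, where `ε` bounds
the mean squared correlation of any fixed row or column with a random one
(`real_sum_colCorrSq_gt_le`).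

Finally `ε` is estimated by non-stationary phase. With horizontal coordinates frozen, the
correlation of two waves over a vertical segment of length `D` is `O(β / (|v - v'| + β))` with `β =
λ L / D`. Integrating in `v'` gives `ε = 64 log (1 + x) / x` with `x = D² / (λ L)`, so that `ε M ≤
64` (`log_one_add_div_le_dof`). The logarithm in `M` is exactly the one produced by this integral.
-/

/-! ### Gaussian integrals and second moments -/

theorem integral_exp_neg_sq_gaussianReal (α y : ℝ) :
    ∫ g, Real.exp (-(y - α * g) ^ 2) ∂(ProbabilityTheory.gaussianReal 0 (1 / 2)) =
      (√(1 + α ^ 2))⁻¹ * Real.exp (-y ^ 2 / (1 + α ^ 2)) := by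
  have hα : 0 < 1 + α ^ 2 := by positivity
  rw [ProbabilityTheory.integral_gaussianReal_eq_integral_smul (by norm_num)]
  -- Complete the square in `g`; variance 1/2 makes the density `π^(-1/2) exp (-g²)`.
  have h1 : ∀ g : ℝ, ProbabilityTheory.gaussianPDFReal 0 (1 / 2) g • Real.exp (-(y - α * g) ^ 2) =
      ((√Real.pi)⁻¹ * Real.exp (-y ^ 2 / (1 + α ^ 2))) *
        Real.exp (-(1 + α ^ 2) * (g - α * y / (1 + α ^ 2)) ^ 2) := by
    intro g
    rw [ProbabilityTheory.gaussianPDFReal, smul_eq_mul]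
    have e1 : (2 * Real.pi * ((1 / 2 : NNReal) : ℝ)) = Real.pi := by push_cast; ring
    have e2 : (2 * ((1 / 2 : NNReal) : ℝ)) = 1 := by push_cast; ring
    rw [e1, e2, mul_assoc, mul_assoc, ← Real.exp_add, ← Real.exp_add]
    congr 2
    field_simp
    ring
  simp_rw [h1]
  rw [integral_const_mul, integral_sub_right_eq_self (fun g => Real.exp (-(1 + α ^ 2) * g ^ 2)),
    integral_gaussian, Real.sqrt_div Real.pi_pos.le]
  have : √Real.pi ≠ 0 := by positivity
  field_simp

theorem integral_complexGaussian {E : Type*} [NormedAddCommGroup E] [NormedSpace ℝ E] (f : ℂ → E) :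
    ∫ z, f z ∂complexGaussian = ∫ p : ℝ × ℝ, f ⟨p.1, p.2⟩
      ∂((ProbabilityTheory.gaussianReal 0 (1 / 2)).prod
        (ProbabilityTheory.gaussianReal 0 (1 / 2))) :=
  integral_map_equiv Complex.measurableEquivRealProd.symm f

instance : IsProbabilityMeasure complexGaussian :=
  Measure.isProbabilityMeasure_map Complex.measurableEquivRealProd.symm.measurable.aemeasurable

instance (N : ℕ) : IsProbabilityMeasure (noiseLaw N) := by
  unfold noiseLaw; infer_instance

theorem integrable_comp_complexGaussian {E : Type*} [NormedAddCommGroup E] (f : ℂ → E) :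
    Integrable f complexGaussian ↔ Integrable (fun p : ℝ × ℝ => f ⟨p.1, p.2⟩)
      ((ProbabilityTheory.gaussianReal 0 (1 / 2)).prod
        (ProbabilityTheory.gaussianReal 0 (1 / 2))) :=
  integrable_map_equiv Complex.measurableEquivRealProd.symm f

/-- Real and imaginary parts are independent, so the integral factors. Up to normalisation it is the
output density of a scalar channel with Gaussian input, which is what normalises `infoDensity`. -/
theorem integral_exp_neg_sq_complexGaussian (α : ℝ) (y : ℂ) :
    ∫ z, Real.exp (-‖y - α * z‖ ^ 2) ∂complexGaussian =
      (1 + α ^ 2)⁻¹ * Real.exp (-‖y‖ ^ 2 / (1 + α ^ 2)) := by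
  rw [integral_complexGaussian]
  have h1 : ∀ p : ℝ × ℝ, Real.exp (-‖y - α * (⟨p.1, p.2⟩ : ℂ)‖ ^ 2) =
      Real.exp (-(y.re - α * p.1) ^ 2) * Real.exp (-(y.im - α * p.2) ^ 2) := by
    intro p
    rw [← Real.exp_add, Complex.sq_norm, Complex.normSq_apply]
    congr 1
    simp
    ring
  simp_rw [h1]
  rw [integral_prod_mul (fun g => Real.exp (-(y.re - α * g) ^ 2))
    (fun g => Real.exp (-(y.im - α * g) ^ 2)), integral_exp_neg_sq_gaussianReal,
    integral_exp_neg_sq_gaussianReal, Complex.sq_norm, Complex.normSq_apply]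
  rw [mul_mul_mul_comm, ← mul_inv, Real.mul_self_sqrt (by positivity), ← Real.exp_add]
  congr 2
  ring

theorem memLp_gaussianReal_two :
    MemLp (fun x : ℝ => x) 2 (ProbabilityTheory.gaussianReal 0 (1 / 2)) :=
  ProbabilityTheory.memLp_id_gaussianReal' 2 (by norm_num)

theorem integral_sq_gaussianReal :
    ∫ x : ℝ, x ^ 2 ∂(ProbabilityTheory.gaussianReal 0 (1 / 2)) = 1 / 2 := by
  have h := ProbabilityTheory.variance_fun_id_gaussianReal (μ := 0) (v := 1 / 2)
  rw [ProbabilityTheory.variance_of_integral_eq_zero (by fun_prop)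
    ProbabilityTheory.integral_id_gaussianReal] at h
  rw [h]
  push_cast
  rfl

theorem integrable_norm_sq_complexGaussian :
    Integrable (fun z : ℂ => ‖z‖ ^ 2) complexGaussian := by
  rw [integrable_comp_complexGaussian]
  have h := memLp_gaussianReal_two.integrable_sq
  have := (h.comp_fst (ProbabilityTheory.gaussianReal 0 (1 / 2))).add
    (h.comp_snd (ProbabilityTheory.gaussianReal 0 (1 / 2)))
  refine this.congr (ae_of_all _ fun p => ?_)
  simp [Complex.sq_norm, Complex.normSq_apply]
  ring

theorem integral_norm_sq_complexGaussian : ∫ z : ℂ, ‖z‖ ^ 2 ∂complexGaussian = 1 := by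
  rw [integral_complexGaussian]
  have h := memLp_gaussianReal_two.integrable_sq
  have h1 : ∀ p : ℝ × ℝ, ‖(⟨p.1, p.2⟩ : ℂ)‖ ^ 2 = p.1 ^ 2 + p.2 ^ 2 := by
    intro p
    simp [Complex.sq_norm, Complex.normSq_apply]
    ring
  simp_rw [h1]
  rw [integral_add (h.comp_fst _) (h.comp_snd _)]
  have e1 := integral_fun_fst (μ := ProbabilityTheory.gaussianReal 0 (1 / 2))
    (ν := ProbabilityTheory.gaussianReal 0 (1 / 2)) (fun x : ℝ => x ^ 2)
  have e2 := integral_fun_snd (μ := ProbabilityTheory.gaussianReal 0 (1 / 2))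
    (ν := ProbabilityTheory.gaussianReal 0 (1 / 2)) (fun x : ℝ => x ^ 2)
  rw [e1, e2, integral_sq_gaussianReal]
  simp
  norm_num

theorem memLp_complexGaussian : MemLp (fun z : ℂ => z) 2 complexGaussian :=
  (memLp_two_iff_integrable_sq_norm (by fun_prop)).2 integrable_norm_sq_complexGaussian

theorem integral_id_complexGaussian : ∫ z : ℂ, z ∂complexGaussian = 0 := by
  have hi : Integrable (fun z : ℂ => z) complexGaussian :=
    memLp_complexGaussian.integrable (by norm_num)
  have h0 : ∫ x : ℝ, x ∂(ProbabilityTheory.gaussianReal 0 (1 / 2)) = 0 :=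
    ProbabilityTheory.integral_id_gaussianReal
  apply Complex.ext
  · have := integral_re (𝕜 := ℂ) hi
    rw [integral_complexGaussian] at this
    simp only [RCLike.re_to_complex] at this
    rw [Complex.zero_re, ← this]
    have e1 := integral_fun_fst (μ := ProbabilityTheory.gaussianReal 0 (1 / 2))
      (ν := ProbabilityTheory.gaussianReal 0 (1 / 2)) (fun x : ℝ => x)
    rw [e1, h0]; simp
  · have := integral_im (𝕜 := ℂ) hi
    rw [integral_complexGaussian] at this
    simp only [RCLike.im_to_complex] at this
    rw [Complex.zero_im, ← this]
    have e1 := integral_fun_snd (μ := ProbabilityTheory.gaussianReal 0 (1 / 2))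
      (ν := ProbabilityTheory.gaussianReal 0 (1 / 2)) (fun x : ℝ => x)
    rw [e1, h0]; simp

theorem memLp_noiseLaw_apply {N : ℕ} (j : Fin N) :
    MemLp (fun g : Fin N → ℂ => g j) 2 (noiseLaw N) :=
  memLp_complexGaussian.comp_measurePreserving
    (measurePreserving_eval (fun _ : Fin N => complexGaussian) j)

theorem integral_noiseLaw_comp {N : ℕ} {E : Type*} [NormedAddCommGroup E] [NormedSpace ℝ E]
    (j : Fin N) (f : ℂ → E) (hf : Continuous f) :
    ∫ g, f (g j) ∂(noiseLaw N) = ∫ z, f z ∂complexGaussian := by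
  have hp := measurePreserving_eval (fun _ : Fin N => complexGaussian) j
  have := integral_map (μ := noiseLaw N) (φ := fun g : Fin N → ℂ => g j) (f := f)
    (measurable_pi_apply j).aemeasurable (by exact hf.aestronglyMeasurable)
  rw [← this]
  congr 1
  exact hp.map_eq

theorem integral_noiseLaw_mul_conj {N : ℕ} (j l : Fin N) :
    ∫ g, g j * (starRingEnd ℂ) (g l) ∂(noiseLaw N) = if j = l then 1 else 0 := by
  split_ifs with h
  · subst h
    rw [integral_noiseLaw_comp j (fun z => z * (starRingEnd ℂ) z) (by fun_prop)]
    have : ∀ z : ℂ, z * (starRingEnd ℂ) z = ((‖z‖ ^ 2 : ℝ) : ℂ) := by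
      intro z; rw [Complex.mul_conj, Complex.sq_norm]
    simp_rw [this]
    rw [integral_complex_ofReal, integral_norm_sq_complexGaussian]; simp
  · have hi : ProbabilityTheory.iIndepFun (fun (i : Fin N) (g : Fin N → ℂ) => g i) (noiseLaw N) :=
      ProbabilityTheory.iIndepFun_pi (X := fun (_ : Fin N) (z : ℂ) => z) (fun _ => by fun_prop)
    have hi2 := (hi.indepFun h).comp (φ := id) (ψ := (starRingEnd ℂ)) measurable_id
      (by fun_prop : Continuous (starRingEnd ℂ)).measurable
    have := hi2.integral_mul_eq_mul_integral
      (measurable_pi_apply j).aestronglyMeasurable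
      ((by fun_prop : Continuous fun g : Fin N → ℂ => (starRingEnd ℂ) (g l)).aestronglyMeasurable)
    simp only [Function.comp_def, id, Pi.mul_def] at this
    rw [this, integral_noiseLaw_comp j (fun z => z) (by fun_prop), integral_id_complexGaussian]
    simp

theorem memLp_noiseLaw_sum {N : ℕ} (w : ℂ) (a : Fin N → ℂ) :
    MemLp (fun g : Fin N → ℂ => w + ∑ j, a j * g j) 2 (noiseLaw N) :=
  (memLp_const w).add (memLp_finsetSum _ fun j _ => (memLp_noiseLaw_apply j).const_mul (a j))

theorem integrable_norm_sq_noiseLaw {N : ℕ} (w : ℂ) (a : Fin N → ℂ) :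
    Integrable (fun g => ‖w + ∑ j, a j * g j‖ ^ 2) (noiseLaw N) :=
  (memLp_two_iff_integrable_sq_norm (memLp_noiseLaw_sum w a).1).1 (memLp_noiseLaw_sum w a)

/-- The coordinates are centred and orthonormal in `L²`, so all cross terms vanish. -/
theorem integral_norm_sq_noiseLaw {N : ℕ} (w : ℂ) (a : Fin N → ℂ) :
    ∫ g, ‖w + ∑ j, a j * g j‖ ^ 2 ∂(noiseLaw N) = ‖w‖ ^ 2 + ∑ j, ‖a j‖ ^ 2 := by
  have hint : ∀ j, Integrable (fun g : Fin N → ℂ => g j) (noiseLaw N) :=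
    fun j => (memLp_noiseLaw_apply j).integrable (by norm_num)
  have hint2 : ∀ j l, Integrable (fun g : Fin N → ℂ => g j * (starRingEnd ℂ) (g l))
      (noiseLaw N) := fun j l =>
    (memLp_noiseLaw_apply j).integrable_mul (memLp_noiseLaw_apply l).star
  have h0 : ∀ j, ∫ g, g j ∂(noiseLaw N) = 0 := fun j => by
    rw [integral_noiseLaw_comp j (fun z => z) (by fun_prop), integral_id_complexGaussian]
  have hS : Integrable (fun g : Fin N → ℂ => ∑ j, a j * g j) (noiseLaw N) :=
    integrable_finsetSum _ fun j _ => (hint j).const_mul _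
  have hSc : Integrable (fun g : Fin N → ℂ => ‖∑ j, a j * g j‖ ^ 2) (noiseLaw N) := by
    simpa using integrable_norm_sq_noiseLaw 0 a
  have hS0 : ∫ g, ∑ j, a j * g j ∂(noiseLaw N) = 0 := by
    rw [integral_finsetSum _ fun j _ => (hint j).const_mul _]
    simp [integral_const_mul, h0]
  have hSS : ∫ g, ‖∑ j, a j * g j‖ ^ 2 ∂(noiseLaw N) = ∑ j, ‖a j‖ ^ 2 := by
    have : ∀ g : Fin N → ℂ, ((‖∑ j, a j * g j‖ ^ 2 : ℝ) : ℂ) =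
        ∑ j, ∑ l, (a j * (starRingEnd ℂ) (a l)) * (g j * (starRingEnd ℂ) (g l)) := by
      intro g
      rw [Complex.sq_norm, ← Complex.mul_conj, map_sum, Finset.sum_mul_sum]
      refine Finset.sum_congr rfl fun j _ => Finset.sum_congr rfl fun l _ => ?_
      rw [map_mul]; ring
    apply Complex.ofReal_injective
    rw [← integral_complex_ofReal]
    simp_rw [this]
    rw [integral_finsetSum _ fun j _ => integrable_finsetSum _ fun l _ => (hint2 j l).const_mul _]
    simp_rw [integral_finsetSum _ fun l _ => (hint2 _ l).const_mul _, integral_const_mul,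
      integral_noiseLaw_mul_conj]
    push_cast
    refine Finset.sum_congr rfl fun j _ => ?_
    simp [Complex.mul_conj, Complex.normSq_eq_norm_sq]
  have hexp : ∀ g : Fin N → ℂ, ‖w + ∑ j, a j * g j‖ ^ 2 =
      ‖w‖ ^ 2 + 2 * inner ℝ w (∑ j, a j * g j) + ‖∑ j, a j * g j‖ ^ 2 :=
    fun g => norm_add_sq_real _ _
  simp_rw [hexp]
  have hlin : Integrable (fun g : Fin N → ℂ => ‖w‖ ^ 2 + 2 * inner ℝ w (∑ j, a j * g j))
      (noiseLaw N) := (integrable_const _).add ((hS.const_inner w).const_mul 2)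
  rw [integral_add hlin hSc, integral_add (integrable_const _) ((hS.const_inner w).const_mul 2), integral_const_mul,
    integral_inner hS, hS0, hSS]
  simp

/-! ### Mutual information of rotated Gaussian inputs -/

open InformationTheory in
/-- The variational lower bound for the Kullback-Leibler divergence. -/
theorem ofReal_integral_le_klDiv {α : Type*} [MeasurableSpace α] (ρ π : Measure α)
    [IsProbabilityMeasure ρ] [IsProbabilityMeasure π] (f : α → ℝ) (hf : Integrable f ρ)
    (he : Integrable (fun x => Real.exp (f x)) π) (h1 : ∫ x, Real.exp (f x) ∂π ≤ 1) :
    ENNReal.ofReal (∫ x, f x ∂ρ) ≤ klDiv ρ π := by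
  by_cases hac : ρ ≪ π
  swap; · rw [klDiv_of_not_ac hac]; exact le_top
  by_cases hint : Integrable (llr ρ π) ρ
  swap; · rw [klDiv_of_not_integrable hint]; exact le_top
  rw [klDiv_of_ac_of_integrable hac hint]
  apply ENNReal.ofReal_le_ofReal
  -- The divergence of `ρ` from the tilted law `exp f · π / ∫ exp f dπ` is nonnegative, which reads
  -- `∫ f dρ ≤ ∫ llr ρ π dρ + log ∫ exp f dπ`; the last term is at most zero.
  have : IsProbabilityMeasure (π.tilted f) := isProbabilityMeasure_tilted he
  have hac' : ρ ≪ π.tilted f := hac.trans (absolutelyContinuous_tilted he)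
  have h2 := integral_llr_add_sub_measure_univ_nonneg hac'
    (integrable_llr_tilted_right hac hf hint he)
  rw [integral_llr_tilted_right hac hf he hint] at h2
  have h3 : Real.log (∫ x, Real.exp (f x) ∂π) ≤ 0 :=
    Real.log_nonpos (integral_nonneg fun x => (Real.exp_pos _).le) h1
  simp at h2 ⊢
  linarith


theorem memLp_noiseLaw_prod {N : ℕ} (j : Fin N) (α : ℂ) (c : Fin N → ℂ) :
    MemLp (fun q : (Fin N → ℂ) × (Fin N → ℂ) => α * q.1 j + ∑ i, c i * q.2 i) 2
      ((noiseLaw N).prod (noiseLaw N)) := by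
  refine (((memLp_noiseLaw_apply j).comp_fst (noiseLaw N)).const_mul α).add ?_
  exact memLp_finsetSum _ fun i _ =>
    ((memLp_noiseLaw_apply i).comp_snd (noiseLaw N)).const_mul (c i)

theorem integrable_norm_sq_noiseLaw_prod {N : ℕ} (j : Fin N) (α : ℂ) (c : Fin N → ℂ) :
    Integrable (fun q : (Fin N → ℂ) × (Fin N → ℂ) => ‖α * q.1 j + ∑ i, c i * q.2 i‖ ^ 2)
      ((noiseLaw N).prod (noiseLaw N)) :=
  (memLp_two_iff_integrable_sq_norm (memLp_noiseLaw_prod j α c).1).1 (memLp_noiseLaw_prod j α c)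

theorem integral_norm_sq_noiseLaw_prod {N : ℕ} (j : Fin N) (α : ℂ) (c : Fin N → ℂ) :
    ∫ q : (Fin N → ℂ) × (Fin N → ℂ), ‖α * q.1 j + ∑ i, c i * q.2 i‖ ^ 2
      ∂((noiseLaw N).prod (noiseLaw N)) = ‖α‖ ^ 2 + ∑ i, ‖c i‖ ^ 2 := by
  rw [integral_prod_symm _ (integrable_norm_sq_noiseLaw_prod j α c)]
  have h1 : ∀ z : Fin N → ℂ, ∫ g, ‖α * g j + ∑ i, c i * z i‖ ^ 2 ∂(noiseLaw N) =
      ‖α‖ ^ 2 + ‖0 + ∑ i, c i * z i‖ ^ 2 := by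
    intro z
    have h := integral_norm_sq_noiseLaw (∑ i, c i * z i) (Pi.single j α)
    have h2 : ∑ l, ‖(Pi.single j α : Fin N → ℂ) l‖ ^ 2 = ‖α‖ ^ 2 := by
      rw [Finset.sum_eq_single_of_mem j (Finset.mem_univ _)
        (fun l _ hl => by simp [Pi.single_eq_of_ne hl]), Pi.single_eq_same]
    rw [h2] at h
    rw [zero_add, add_comm (‖α‖ ^ 2), ← h]
    refine integral_congr_ae (ae_of_all _ fun g => ?_)
    simp only
    rw [Finset.sum_eq_single_of_mem (f := fun l => (Pi.single j α : Fin N → ℂ) l * g l) j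
      (Finset.mem_univ _) (fun l _ hl => by simp [Pi.single_eq_of_ne hl]), Pi.single_eq_same,
      add_comm]
  simp_rw [h1]
  rw [integral_add (integrable_const _) (integrable_norm_sq_noiseLaw 0 c),
    integral_norm_sq_noiseLaw]
  simp

/-- The information density of the scalar Gaussian channel `y = a s + w` with input power `P` and
unit noise power. -/
noncomputable def infoDensity (P a : ℝ) (s y : ℂ) : ℝ :=
  -‖y - a * s‖ ^ 2 + ‖y‖ ^ 2 / (1 + P * a ^ 2) + Real.log (1 + P * a ^ 2)

/-- The exponential is the likelihood ratio of the conditional output density to the output density,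
so averaging it over the Gaussian input gives one. This holds at every single `y`, hence whatever
law is put on `y`. -/
theorem integral_exp_infoDensity {P : ℝ} (hP : 0 < P) (a : ℝ) (y : ℂ) :
    ∫ z, Real.exp (infoDensity P a (√P * z) y) ∂complexGaussian = 1 := by
  have h : ∀ z : ℂ, Real.exp (infoDensity P a (√P * z) y) =
      ((1 + P * a ^ 2) * Real.exp (‖y‖ ^ 2 / (1 + P * a ^ 2))) *
        Real.exp (-‖y - ((a * √P : ℝ) : ℂ) * z‖ ^ 2) := by
    intro z
    rw [infoDensity, Real.exp_add, Real.exp_add, Real.exp_log (by positivity)]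
    push_cast
    rw [mul_assoc (a : ℂ)]
    ring
  simp_rw [h]
  rw [integral_const_mul, integral_exp_neg_sq_complexGaussian, mul_pow, Real.sq_sqrt hP.le,
    mul_comm (a ^ 2) P]
  have h1 : 0 < 1 + P * a ^ 2 := by positivity
  rw [mul_mul_mul_comm, mul_inv_cancel₀ h1.ne', ← Real.exp_add, ← add_div, add_neg_cancel, zero_div,
    Real.exp_zero, one_mul]

/-- The law of the input obtained by rotating i.i.d. complex Gaussians of power `P` by `V`. -/
noncomputable def rotatedInput {N : ℕ} (P : ℝ) (V : Matrix (Fin N) (Fin N) ℂ) :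
    Measure (Fin N → ℂ) :=
  (noiseLaw N).map fun g => V.mulVec fun j => √P * g j

theorem continuous_rotate {N : ℕ} (P : ℝ) (V : Matrix (Fin N) (Fin N) ℂ) :
    Continuous fun g : Fin N → ℂ => V.mulVec fun j => (√P : ℂ) * g j := by
  fun_prop

instance {N : ℕ} (P : ℝ) (V : Matrix (Fin N) (Fin N) ℂ) :
    IsProbabilityMeasure (rotatedInput P V) :=
  Measure.isProbabilityMeasure_map (continuous_rotate P V).measurable.aemeasurable

/-- The rows of a unitary matrix have unit norm, so the rotation leaves power `P` at every node
separately, as the per-node constraint demands. -/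
theorem isAdmissibleInput_rotatedInput {N : ℕ} {P : ℝ} (hP : 0 < P)
    {V : Matrix (Fin N) (Fin N) ℂ} (hV : V * V.conjTranspose = 1) :
    IsAdmissibleInput P (rotatedInput P V) := by
  refine ⟨inferInstance, fun k => ?_⟩
  rw [rotatedInput, lintegral_map (by fun_prop) (continuous_rotate P V).measurable]
  have h1 : ∀ g : Fin N → ℂ, ‖V.mulVec (fun j => (√P : ℂ) * g j) k‖ₑ ^ 2 =
      ENNReal.ofReal (‖0 + ∑ j, (V k j * √P) * g j‖ ^ 2) := by
    intro g
    rw [ENNReal.ofReal_pow (norm_nonneg _), ofReal_norm, zero_add]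
    simp only [Matrix.mulVec, dotProduct, mul_assoc]
  simp_rw [h1]
  rw [← ofReal_integral_eq_lintegral_ofReal (integrable_norm_sq_noiseLaw _ _)
    (ae_of_all _ fun _ => by positivity), integral_norm_sq_noiseLaw]
  apply ENNReal.ofReal_le_ofReal
  have h2 : ∑ j, ‖V k j‖ ^ 2 = 1 := by
    have := congrFun (congrFun hV k) k
    rw [Matrix.mul_apply, Matrix.one_apply_eq] at this
    simp only [Matrix.conjTranspose_apply, RCLike.star_def, Complex.mul_conj,
      Complex.normSq_eq_norm_sq] at this
    exact_mod_cast this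
  simp only [norm_mul, mul_pow, ← Finset.sum_mul, h2]
  simp [Real.sq_sqrt hP.le, abs_of_nonneg]

theorem jointLaw_rotatedInput {N : ℕ} (P : ℝ) (V H : Matrix (Fin N) (Fin N) ℂ) :
    jointLaw H (rotatedInput P V) = ((noiseLaw N).prod (noiseLaw N)).map fun q =>
      (V.mulVec (fun j => (√P : ℂ) * q.1 j), H.mulVec (V.mulVec fun j => (√P : ℂ) * q.1 j) + q.2) := by
  have hm := (continuous_rotate P V).measurable
  have h := Measure.map_prod_map (noiseLaw N) (noiseLaw N) hm measurable_id
  rw [Measure.map_id] at h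
  rw [jointLaw, rotatedInput, h, Measure.map_map (by fun_prop) (hm.prodMap measurable_id)]
  rfl

instance {N : ℕ} (H : Matrix (Fin N) (Fin N) ℂ) (p : Measure (Fin N → ℂ))
    [IsProbabilityMeasure p] : IsProbabilityMeasure (jointLaw H p) :=
  Measure.isProbabilityMeasure_map (by fun_prop)

theorem fst_jointLaw {N : ℕ} (H : Matrix (Fin N) (Fin N) ℂ) (p : Measure (Fin N → ℂ))
    [IsProbabilityMeasure p] : (jointLaw H p).fst = p := by
  rw [jointLaw, Measure.fst_map_prodMk (by fun_prop), ← Measure.fst, Measure.fst_prod]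

/-- The information density of the parallel channels obtained from the singular value
decomposition. -/
noncomputable def totalInfoDensity {N : ℕ} (P : ℝ) (H V : Matrix (Fin N) (Fin N) ℂ)
    (ev : Fin N → ℝ) (J : Finset (Fin N)) (q : (Fin N → ℂ) × (Fin N → ℂ)) : ℝ :=
  ∑ j ∈ J, infoDensity P √(ev j) (V.conjTranspose.mulVec q.1 j)
    ((H * V).conjTranspose.mulVec q.2 j / √(ev j))

theorem continuous_totalInfoDensity {N : ℕ} (P : ℝ) (H V : Matrix (Fin N) (Fin N) ℂ)
    (ev : Fin N → ℝ) (J : Finset (Fin N)) : Continuous (totalInfoDensity P H V ev J) := by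
  unfold totalInfoDensity infoDensity
  fun_prop

theorem integral_exp_totalInfoDensity {N : ℕ} {P : ℝ} (hP : 0 < P)
    (H : Matrix (Fin N) (Fin N) ℂ) {V : Matrix (Fin N) (Fin N) ℂ} (hV : V.conjTranspose * V = 1)
    (ev : Fin N → ℝ) (J : Finset (Fin N)) (y : Fin N → ℂ) :
    ∫ x, Real.exp (totalInfoDensity P H V ev J (x, y)) ∂(rotatedInput P V) = 1 := by
  have hc : Continuous fun x => Real.exp (totalInfoDensity P H V ev J (x, y)) :=
    Real.continuous_exp.comp ((continuous_totalInfoDensity P H V ev J).comp (by fun_prop))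
  rw [rotatedInput, integral_map (continuous_rotate P V).measurable.aemeasurable
    hc.aestronglyMeasurable]
  -- `Vᴴ V = 1` undoes the rotation, and the exponential becomes a product over independent
  -- coordinates; those outside `J` contribute the factor one.
  have h1 : ∀ g : Fin N → ℂ,
      Real.exp (totalInfoDensity P H V ev J (V.mulVec fun j => (√P : ℂ) * g j, y)) =
      ∏ j, (fun j z => if j ∈ J then Real.exp (infoDensity P √(ev j) (√P * z)
        ((H * V).conjTranspose.mulVec y j / √(ev j))) else 1) j (g j) := by
    intro g
    simp only
    rw [Finset.prod_ite_mem, Finset.univ_inter, ← Real.exp_sum]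
    simp only [totalInfoDensity, Matrix.mulVec_mulVec, hV, Matrix.one_mulVec]
  rw [integral_congr_ae (ae_of_all _ h1), noiseLaw]
  refine (integral_fintype_prod_eq_prod (fun (j : Fin N) (z : ℂ) => if j ∈ J then
    Real.exp (infoDensity P √(ev j) (√P * z) ((H * V).conjTranspose.mulVec y j / √(ev j)))
      else 1)).trans ?_
  refine Finset.prod_eq_one fun j _ => ?_
  by_cases hj : j ∈ J
  · simp only [hj, if_true]
    exact integral_exp_infoDensity hP _ _
  · simp [hj]

/-- The columns of `H V` are orthogonal, so the matched filter output divided by `√(ev j)` is `√(ev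
j) s_j` plus noise of unit power. The residual and the output normalised by `1 + P ev j` both have
second moment one; they enter with opposite signs and cancel, leaving the logarithms. -/
theorem integral_totalInfoDensity {N : ℕ} {P : ℝ} (hP : 0 < P)
    {H V : Matrix (Fin N) (Fin N) ℂ} (hV : V.conjTranspose * V = 1) {ev : Fin N → ℝ}
    (hB : (H * V).conjTranspose * (H * V) = Matrix.diagonal fun j => (ev j : ℂ))
    {J : Finset (Fin N)} (hJ : ∀ j ∈ J, 0 < ev j) :
    Integrable (totalInfoDensity P H V ev J) (jointLaw H (rotatedInput P V)) ∧
    ∫ q, totalInfoDensity P H V ev J q ∂(jointLaw H (rotatedInput P V)) =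
      ∑ j ∈ J, Real.log (1 + P * ev j) := by
  have hc := continuous_totalInfoDensity P H V ev J
  set B := H * V with hBdef
  have hBH : ∀ s z : Fin N → ℂ, ∀ j, B.conjTranspose.mulVec (H.mulVec (V.mulVec s) + z) j =
      ev j * s j + ∑ i, (starRingEnd ℂ) (B i j) * z i := by
    intro s z j
    rw [Matrix.mulVec_add, Matrix.mulVec_mulVec s H V, ← hBdef, Matrix.mulVec_mulVec, hB,
      Pi.add_apply, Matrix.mulVec_diagonal]
    rfl
  have hBn : ∀ j, ∑ i, ‖B i j‖ ^ 2 = ev j := by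
    intro j
    have := congrFun (congrFun hB j) j
    rw [Matrix.mul_apply, Matrix.diagonal_apply_eq] at this
    simp only [Matrix.conjTranspose_apply, RCLike.star_def, Complex.conj_mul'] at this
    exact_mod_cast this
  -- The vacuous term `0 * q.1 j` gives the residual the same shape as the output, so that one
  -- moment formula serves both.
  have hf : ∀ q : (Fin N → ℂ) × (Fin N → ℂ), totalInfoDensity P H V ev J
      (V.mulVec (fun j => (√P : ℂ) * q.1 j), H.mulVec (V.mulVec fun j => (√P : ℂ) * q.1 j) + q.2) =
      ∑ j ∈ J, (-‖0 * q.1 j + ∑ i, ((starRingEnd ℂ) (B i j) / √(ev j)) * q.2 i‖ ^ 2 +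
        ‖((√(ev j) * √P : ℝ) : ℂ) * q.1 j +
          ∑ i, ((starRingEnd ℂ) (B i j) / √(ev j)) * q.2 i‖ ^ 2 / (1 + P * ev j) +
        Real.log (1 + P * ev j)) := by
    intro q
    rw [totalInfoDensity]
    refine Finset.sum_congr rfl fun j hj => ?_
    have hpos := hJ j hj
    have hs : ((√(ev j) : ℝ) : ℂ) ≠ 0 := by
      exact_mod_cast (Real.sqrt_pos.2 hpos).ne'
    have hss : ((ev j : ℝ) : ℂ) = (√(ev j) : ℂ) * √(ev j) := by
      rw [← Complex.ofReal_mul, Real.mul_self_sqrt hpos.le]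
    rw [← hBdef, hBH, Matrix.mulVec_mulVec, hV, Matrix.one_mulVec, infoDensity,
      Real.sq_sqrt hpos.le]
    have e1 : ((ev j : ℂ) * (√P * q.1 j) + ∑ i, (starRingEnd ℂ) (B i j) * q.2 i) / √(ev j) =
        ((√(ev j) * √P : ℝ) : ℂ) * q.1 j +
          ∑ i, ((starRingEnd ℂ) (B i j) / √(ev j)) * q.2 i := by
      rw [add_div, Finset.sum_div]
      congr 1
      · rw [hss]; push_cast; field_simp
      · exact Finset.sum_congr rfl fun i _ => by ring
    have e2 : ((√(ev j) * √P : ℝ) : ℂ) * q.1 j +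
        ∑ i, ((starRingEnd ℂ) (B i j) / √(ev j)) * q.2 i - √(ev j) * (√P * q.1 j) =
        0 * q.1 j + ∑ i, ((starRingEnd ℂ) (B i j) / √(ev j)) * q.2 i := by
      push_cast
      ring
    rw [e1, e2]
  have hcn : ∀ j ∈ J, ∑ i, ‖(starRingEnd ℂ) (B i j) / (√(ev j) : ℂ)‖ ^ 2 = 1 := by
    intro j hj
    have hpos := hJ j hj
    simp only [norm_div, div_pow, RCLike.norm_conj, ← Finset.sum_div, hBn, Complex.norm_real,
      Real.norm_eq_abs, sq_abs, Real.sq_sqrt hpos.le]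
    exact div_self hpos.ne'
  have hi1 := fun j => (integrable_norm_sq_noiseLaw_prod j 0
    (fun i => (starRingEnd ℂ) (B i j) / √(ev j))).neg
  have hi2 := fun j => (integrable_norm_sq_noiseLaw_prod j ((√(ev j) * √P : ℝ) : ℂ)
    (fun i => (starRingEnd ℂ) (B i j) / √(ev j))).div_const (1 + P * ev j)
  have hi3 := fun j => ((hi1 j).add (hi2 j)).add (integrable_const (Real.log (1 + P * ev j)))
  have hm : Measurable fun q : (Fin N → ℂ) × (Fin N → ℂ) => (V.mulVec (fun j => (√P : ℂ) * q.1 j),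
      H.mulVec (V.mulVec fun j => (√P : ℂ) * q.1 j) + q.2) :=
    Continuous.measurable (by fun_prop)
  rw [jointLaw_rotatedInput]
  constructor
  · rw [integrable_map_measure hc.aestronglyMeasurable hm.aemeasurable]
    refine (integrable_finsetSum J fun j _ => hi3 j).congr (ae_of_all _ fun q => ?_)
    rw [Function.comp_apply, hf q]
    rfl
  · rw [integral_map hm.aemeasurable hc.aestronglyMeasurable]
    rw [integral_congr_ae (ae_of_all _ hf)]
    refine (integral_finsetSum J fun j _ => hi3 j).trans ?_
    refine Finset.sum_congr rfl fun j hj => ?_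
    have hpos := hJ j hj
    have e := integral_add ((hi1 j).add (hi2 j)) (integrable_const (Real.log (1 + P * ev j)))
    have e' := integral_add (hi1 j) (hi2 j)
    refine e.trans ((congrArg (· + _) e').trans ?_)
    simp only [Pi.neg_apply]
    rw [integral_neg, integral_div, integral_norm_sq_noiseLaw_prod,
      integral_norm_sq_noiseLaw_prod, hcn j hj]
    have : 0 < 1 + P * ev j := by positivity
    simp only [Complex.norm_real, Real.norm_eq_abs, sq_abs, mul_pow, Real.sq_sqrt hpos.le,
      Real.sq_sqrt hP.le]
    rw [mul_comm (ev j) P, add_comm (P * ev j) 1, div_self this.ne']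
    simp

/-- The information density is a legitimate test function for the variational bound, and its mean
under the joint law is the sum of logarithms. Restricting to `J` avoids division by vanishing
singular values. -/
theorem sum_logb_le_capacity {N : ℕ} {P : ℝ} (hP : 0 < P)
    {H V : Matrix (Fin N) (Fin N) ℂ} (hV : V.conjTranspose * V = 1) {ev : Fin N → ℝ}
    (hB : (H * V).conjTranspose * (H * V) = Matrix.diagonal fun j => (ev j : ℂ))
    {J : Finset (Fin N)} (hJ : ∀ j ∈ J, 0 < ev j) :
    ENNReal.ofReal (∑ j ∈ J, Real.logb 2 (1 + P * ev j)) ≤ capacity P H := by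
  have hV' : V * V.conjTranspose = 1 := mul_eq_one_comm.1 hV
  refine le_trans ?_ (le_iSup₂ (f := fun (p : Measure (Fin N → ℂ)) (_ : IsAdmissibleInput P p) =>
    mutualInfo (jointLaw H p)) (rotatedInput P V) (isAdmissibleInput_rotatedInput hP hV'))
  rw [mutualInfo, fst_jointLaw]
  obtain ⟨hi, he⟩ := integral_totalInfoDensity hP hV hB hJ
  simp only [Real.logb, ← Finset.sum_div]
  rw [ENNReal.ofReal_div_of_pos (Real.log_pos (by norm_num)), ← he]
  gcongr
  have hc : Continuous fun q => Real.exp (totalInfoDensity P H V ev J q) :=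
    Real.continuous_exp.comp (continuous_totalInfoDensity P H V ev J)
  have h1 := integral_exp_totalInfoDensity hP H hV ev J
  have hint : Integrable (fun q => Real.exp (totalInfoDensity P H V ev J q))
      ((rotatedInput P V).prod (jointLaw H (rotatedInput P V)).snd) := by
    rw [integrable_prod_iff' hc.aestronglyMeasurable]
    refine ⟨ae_of_all _ fun y => ?_, ?_⟩
    -- The integral of a non-integrable function is 0 by convention, so the value 1 proves
    -- integrability.
    · exact Integrable.of_integral_ne_zero (by rw [h1 y]; norm_num)
    · simp_rw [Real.norm_eq_abs, Real.abs_exp, h1]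
      exact integrable_const _
  refine ofReal_integral_le_klDiv _ _ _ hi hint ?_
  rw [integral_prod_symm _ hint]
  simp_rw [h1]
  simp


/-! ### Counting large eigenvalues through traces -/

/-- A Paley–Zygmund type count of the large terms of a finite sum. -/
theorem sq_sum_le_card_filter_mul_sum_sq {N : ℕ} (hN : 0 < N) (ev : Fin N → ℝ) (h0 : 0 ≤ ∑ j, ev j) :
    (∑ j, ev j) ^ 2 ≤ 4 * ((Finset.univ.filter fun j => (∑ l, ev l) / (2 * N) ≤ ev j).card *
      ∑ j, ev j ^ 2) := by
  set S := ∑ l, ev l with hS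
  set J := Finset.univ.filter fun j => S / (2 * N) ≤ ev j
  have hN' : (0 : ℝ) < N := by exact_mod_cast hN
  -- At most `N` terms lie below `S / (2 N)`, so together they carry at most `S / 2`; Cauchy–Schwarz
  -- on the remaining terms finishes.
  have h1 : S / 2 ≤ ∑ j ∈ J, ev j := by
    have e := Finset.sum_filter_add_sum_filter_not Finset.univ (fun j => S / (2 * N) ≤ ev j) ev
    have h2 : ∑ j ∈ Finset.univ.filter (fun j => ¬ S / (2 * N) ≤ ev j), ev j ≤ S / 2 := by
      calc _ ≤ ∑ j ∈ Finset.univ.filter (fun j => ¬ S / (2 * N) ≤ ev j), S / (2 * N) :=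
            Finset.sum_le_sum fun j hj => (not_le.1 (Finset.mem_filter.1 hj).2).le
        _ ≤ ∑ _j : Fin N, S / (2 * N) :=
            Finset.sum_le_sum_of_subset_of_nonneg (Finset.subset_univ _)
              fun _ _ _ => by positivity
        _ = S / 2 := by simp; field_simp
    rw [← hS] at e
    linarith
  have h3 : (∑ j ∈ J, ev j) ^ 2 ≤ J.card * ∑ j ∈ J, ev j ^ 2 := sq_sum_le_card_mul_sum_sq
  have h4 : ∑ j ∈ J, ev j ^ 2 ≤ ∑ j, ev j ^ 2 :=
    Finset.sum_le_sum_of_subset_of_nonneg (Finset.subset_univ _) fun _ _ _ => sq_nonneg _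
  have h5 : (S / 2) ^ 2 ≤ (∑ j ∈ J, ev j) ^ 2 := by gcongr
  have h6 : (J.card : ℝ) * ∑ j ∈ J, ev j ^ 2 ≤ J.card * ∑ j, ev j ^ 2 := by gcongr
  linarith

/-- Spectral theorem for `Hᴴ H`. The two sums are its trace and the trace of its square, expressed
through entries so that no eigenvalue has to be located. -/
theorem exists_gram_diagonalization {N : ℕ} (H : Matrix (Fin N) (Fin N) ℂ) :
    ∃ (V : Matrix (Fin N) (Fin N) ℂ) (ev : Fin N → ℝ), V.conjTranspose * V = 1 ∧
      (H * V).conjTranspose * (H * V) = Matrix.diagonal (fun j => (ev j : ℂ)) ∧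
      ∑ j, ev j = ∑ i, ∑ k, ‖H i k‖ ^ 2 ∧
      ∑ j, ev j ^ 2 = ∑ k, ∑ k', ‖∑ i, H i k * (starRingEnd ℂ) (H i k')‖ ^ 2 := by
  have hA : (H.conjTranspose * H).IsHermitian := Matrix.isHermitian_conjTranspose_mul_self H
  set V : Matrix (Fin N) (Fin N) ℂ := hA.eigenvectorUnitary.1
  have hV : V.conjTranspose * V = 1 := Unitary.coe_star_mul_self hA.eigenvectorUnitary
  have hV' : V * V.conjTranspose = 1 := mul_eq_one_comm.1 hV
  have hD : (H * V).conjTranspose * (H * V) = Matrix.diagonal fun j => (hA.eigenvalues j : ℂ) := by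
    have h := hA.conjStarAlgAut_star_eigenvectorUnitary
    rw [Unitary.conjStarAlgAut_star_apply] at h
    rw [Matrix.conjTranspose_mul, Matrix.mul_assoc, ← Matrix.mul_assoc _ H, ← Matrix.mul_assoc]
    exact h
  have htr : ∀ k k', (H.conjTranspose * H) k k' = ∑ i, (starRingEnd ℂ) (H i k) * H i k' :=
    fun k k' => by rw [Matrix.mul_apply]; rfl
  refine ⟨V, hA.eigenvalues, hV, hD, ?_, ?_⟩
  · have h := hA.trace_eq_sum_eigenvalues
    apply Complex.ofReal_injective
    rw [Complex.ofReal_sum]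
    refine h.symm.trans ?_
    rw [Matrix.trace, Finset.sum_comm]
    push_cast
    refine Finset.sum_congr rfl fun k _ => ?_
    rw [Matrix.diag_apply, htr]
    exact Finset.sum_congr rfl fun i _ => by rw [Complex.conj_mul']
  · apply Complex.ofReal_injective
    have h1 : ((∑ j, hA.eigenvalues j ^ 2 : ℝ) : ℂ) =
        Matrix.trace (((H * V).conjTranspose * (H * V)) * ((H * V).conjTranspose * (H * V))) := by
      rw [hD, Matrix.diagonal_mul_diagonal, Matrix.trace_diagonal]
      push_cast
      exact Finset.sum_congr rfl fun j _ => by ring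
    have h2 : ((H * V).conjTranspose * (H * V)) * ((H * V).conjTranspose * (H * V)) =
        V.conjTranspose * ((H.conjTranspose * H) * (H.conjTranspose * H) * V) := by
      rw [Matrix.conjTranspose_mul]
      calc _ = V.conjTranspose * (H.conjTranspose * H) * (V * V.conjTranspose) *
            (H.conjTranspose * H) * V := by noncomm_ring
        _ = _ := by rw [hV']; noncomm_ring
    rw [h1, h2, Matrix.trace_mul_comm, Matrix.mul_assoc, hV', Matrix.mul_one, Matrix.trace]
    push_cast
    refine Finset.sum_congr rfl fun k _ => ?_
    rw [Matrix.diag_apply, Matrix.mul_apply]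
    refine Finset.sum_congr rfl fun k' _ => ?_
    rw [htr, htr, ← Complex.conj_mul', map_sum]
    simp only [map_mul, Complex.conj_conj]
    congr 1
    exact Finset.sum_congr rfl fun i _ => mul_comm _ _

/-- Keep only the eigenvalues that are at least half the mean: each contributes at least the stated
logarithm, and the Paley–Zygmund count bounds their number below. -/
theorem trace_bound_le_capacity {N : ℕ} (hN : 0 < N) {P : ℝ} (hP : 0 < P)
    (H : Matrix (Fin N) (Fin N) ℂ) (htr : 0 < ∑ i, ∑ k, ‖H i k‖ ^ 2) :
    ENNReal.ofReal ((∑ i, ∑ k, ‖H i k‖ ^ 2) ^ 2 /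
        (4 * ∑ k, ∑ k', ‖∑ i, H i k * (starRingEnd ℂ) (H i k')‖ ^ 2) *
      Real.logb 2 (1 + P * ((∑ i, ∑ k, ‖H i k‖ ^ 2) / (2 * N)))) ≤ capacity P H := by
  obtain ⟨V, ev, hV, hB, h1, h2⟩ := exists_gram_diagonalization H
  rw [← h1] at htr
  rw [← h1, ← h2]
  have hN' : (0 : ℝ) < N := by exact_mod_cast hN
  have hpos : 0 < (∑ j, ev j) / (2 * N) := by positivity
  refine le_trans (ENNReal.ofReal_le_ofReal ?_) (sum_logb_le_capacity hP hV hB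
    (J := Finset.univ.filter fun j => (∑ l, ev l) / (2 * N) ≤ ev j)
    fun j hj => hpos.trans_le (Finset.mem_filter.1 hj).2)
  have hc := sq_sum_le_card_filter_mul_sum_sq hN ev htr.le
  have hlog : 0 ≤ Real.logb 2 (1 + P * ((∑ j, ev j) / (2 * N))) :=
    Real.logb_nonneg (by norm_num) (by nlinarith [mul_pos hP hpos])
  calc _ ≤ ((Finset.univ.filter fun j => (∑ l, ev l) / (2 * N) ≤ ev j).card : ℝ) *
        Real.logb 2 (1 + P * ((∑ j, ev j) / (2 * N))) := by
        gcongr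
        apply div_le_of_le_mul₀ (by positivity) (by positivity)
        linarith
    _ = ∑ j ∈ Finset.univ.filter (fun j => (∑ l, ev l) / (2 * N) ≤ ev j),
        Real.logb 2 (1 + P * ((∑ j, ev j) / (2 * N))) := by simp
    _ ≤ _ := by
        refine Finset.sum_le_sum fun j hj => ?_
        have := (Finset.mem_filter.1 hj).2
        apply Real.logb_le_logb_of_le (by norm_num) (by positivity)
        gcongr


/-! ### Variance of U-statistics of order two -/

section UStatistic

variable {α : Type*} [MeasurableSpace α] {N : ℕ}

theorem iIndepFun_eval (μ : Measure α) [IsProbabilityMeasure μ] :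
    ProbabilityTheory.iIndepFun (fun (i : Fin N) (x : Fin N → α) => x i)
      (Measure.pi fun _ : Fin N => μ) :=
  ProbabilityTheory.iIndepFun_pi (X := fun (_ : Fin N) (z : α) => z) (fun _ => by fun_prop)

theorem measurePreserving_pair (μ : Measure α) [IsProbabilityMeasure μ] {a b : Fin N}
    (hab : a ≠ b) :
    MeasurePreserving (fun x : Fin N → α => (x a, x b)) (Measure.pi fun _ => μ) (μ.prod μ) := by
  refine ⟨by fun_prop, ?_⟩
  have h := (ProbabilityTheory.indepFun_iff_map_prod_eq_prod_map_map
    (measurable_pi_apply a).aemeasurable (measurable_pi_apply b).aemeasurable).1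
    ((iIndepFun_eval μ).indepFun hab)
  rw [h]
  have e := fun i => (measurePreserving_eval (fun _ : Fin N => μ) i).map_eq
  exact congrArg₂ _ (e a) (e b)

theorem measurePreserving_triple (μ : Measure α) [IsProbabilityMeasure μ] {a b c : Fin N}
    (hab : a ≠ b) (hac : a ≠ c) (hbc : b ≠ c) :
    MeasurePreserving (fun x : Fin N → α => (x a, (x b, x c))) (Measure.pi fun _ => μ)
      (μ.prod (μ.prod μ)) := by
  refine ⟨by fun_prop, ?_⟩
  have h := (ProbabilityTheory.indepFun_iff_map_prod_eq_prod_map_map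
    (measurable_pi_apply a).aemeasurable
    ((measurable_pi_apply b).prodMk (measurable_pi_apply c)).aemeasurable).1
    ((iIndepFun_eval μ).indepFun_prodMk (fun i => measurable_pi_apply i) b c a hab.symm
      hac.symm).symm
  rw [h]
  have e := (measurePreserving_eval (fun _ : Fin N => μ) a).map_eq
  exact congrArg₂ _ e (measurePreserving_pair μ hbc).map_eq

theorem integral_comp_measurePreserving {α β : Type*} [MeasurableSpace α] [MeasurableSpace β]
    {μ : Measure α} {ν : Measure β} {φ : α → β} (h : MeasurePreserving φ μ ν) {f : β → ℝ}
    (hf : Measurable f) : ∫ x, f (φ x) ∂μ = ∫ y, f y ∂ν := by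
  rw [← h.map_eq, integral_map h.measurable.aemeasurable hf.aestronglyMeasurable]

theorem integrable_of_bounded {β E : Type*} [MeasurableSpace β] [NormedAddCommGroup E]
    [MeasurableSpace E] [BorelSpace E] [SecondCountableTopology E]
    {μ : Measure β} [IsFiniteMeasure μ] {f : β → E} (hf : Measurable f) {B : ℝ}
    (hB : ∀ x, ‖f x‖ ≤ B) : Integrable f μ :=
  Integrable.of_bound hf.aestronglyMeasurable B (ae_of_all _ hB)

variable {μ : Measure α} [IsProbabilityMeasure μ] {K : α → α → ℝ}

theorem integral_kernel_pair (hK : Measurable (Function.uncurry K)) {B : ℝ}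
    (hB : ∀ x y, |K x y| ≤ B) {a b : Fin N} (hab : a ≠ b) :
    ∫ x, K (x a) (x b) ∂(Measure.pi fun _ => μ) = ∫ x, ∫ y, K x y ∂μ ∂μ := by
  refine (integral_comp_measurePreserving (measurePreserving_pair μ hab) hK).trans ?_
  rw [integral_prod _ (integrable_of_bounded hK fun p => hB p.1 p.2)]
  rfl

theorem integral_kernel_sq (hK : Measurable (Function.uncurry K)) {B : ℝ}
    (hB : ∀ x y, |K x y| ≤ B) {a b : Fin N} (hab : a ≠ b) :
    ∫ x, K (x a) (x b) * K (x a) (x b) ∂(Measure.pi fun _ => μ) =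
      ∫ x, ∫ y, K x y ^ 2 ∂μ ∂μ := by
  have h := integral_kernel_pair (μ := μ) (K := fun x y => K x y ^ 2) (B := B ^ 2)
    (hK.pow_const 2) (fun x y => by rw [abs_pow]; gcongr; exact hB x y) hab
  rw [← h]
  simp_rw [pow_two]

theorem integral_kernel_triple (hK : Measurable (Function.uncurry K)) {B : ℝ}
    (hB : ∀ x y, |K x y| ≤ B) {a b c : Fin N} (hab : a ≠ b) (hac : a ≠ c) (hbc : b ≠ c) :
    ∫ x, K (x a) (x b) * K (x a) (x c) ∂(Measure.pi fun _ => μ) =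
      ∫ x, (∫ y, K x y ∂μ) ^ 2 ∂μ := by
  have hm1 : Measurable fun p : α × α × α => K p.1 p.2.1 :=
    hK.comp (measurable_fst.prodMk (measurable_fst.comp measurable_snd))
  have hm2 : Measurable fun p : α × α × α => K p.1 p.2.2 :=
    hK.comp (measurable_fst.prodMk (measurable_snd.comp measurable_snd))
  rw [integral_comp_measurePreserving (measurePreserving_triple μ hab hac hbc)
    (f := fun p : α × α × α => K p.1 p.2.1 * K p.1 p.2.2) (hm1.mul hm2),
    integral_prod (fun p : α × α × α => K p.1 p.2.1 * K p.1 p.2.2) (integrable_of_bounded (hm1.mul hm2) (B := B * B) fun p => ?_)]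
  · refine integral_congr_ae (ae_of_all _ fun x => ?_)
    simp only
    rw [integral_prod_mul (fun y => K x y) (fun y => K x y), pow_two]
  · rw [Real.norm_eq_abs, abs_mul]
    exact mul_le_mul (hB _ _) (hB _ _) (abs_nonneg _) ((abs_nonneg _).trans (hB p.1 p.1))

theorem integral_kernel_disjoint (hK : Measurable (Function.uncurry K)) {B : ℝ}
    (hB : ∀ x y, |K x y| ≤ B) (h0 : ∫ x, ∫ y, K x y ∂μ ∂μ = 0) {a b c d : Fin N} (hab : a ≠ b)
    (hac : a ≠ c) (had : a ≠ d) (hbc : b ≠ c) (hbd : b ≠ d) :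
    ∫ x, K (x a) (x b) * K (x c) (x d) ∂(Measure.pi fun _ => μ) = 0 := by
  have h := ((iIndepFun_eval μ).indepFun_prodMk_prodMk (fun i => measurable_pi_apply i) a b c d
    hac had hbc hbd).comp hK hK
  have hm : ∀ a b : Fin N, Measurable fun x : Fin N → α => Function.uncurry K (x a, x b) :=
    fun a b => hK.comp (by fun_prop)
  have e := h.integral_mul_eq_mul_integral (hm a b).aestronglyMeasurable
    (hm c d).aestronglyMeasurable
  have e2 : ∫ x, K (x a) (x b) ∂(Measure.pi fun _ => μ) = 0 :=
    (integral_kernel_pair hK hB hab).trans h0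
  refine e.trans ?_
  exact mul_eq_zero_of_left e2 _

/-- The second moment of a centered `U`-statistic of order two. -/
theorem integral_sq_offDiag_le_of_centered (hK : Measurable (Function.uncurry K))
    (hs : ∀ x y, K x y = K y x) {B : ℝ} (hB : ∀ x y, |K x y| ≤ B)
    (h0 : ∫ x, ∫ y, K x y ∂μ ∂μ = 0) :
    ∫ x : Fin N → α, (∑ k, ∑ k', if k = k' then 0 else K (x k) (x k')) ^ 2
      ∂(Measure.pi fun _ => μ) ≤
    4 * N ^ 3 * ∫ x, (∫ y, K x y ∂μ) ^ 2 ∂μ + 2 * N ^ 2 * ∫ x, ∫ y, K x y ^ 2 ∂μ ∂μ := by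
  set A := ∫ x, (∫ y, K x y ∂μ) ^ 2 ∂μ with hA
  set C := ∫ x, ∫ y, K x y ^ 2 ∂μ ∂μ with hC
  have hA0 : 0 ≤ A := integral_nonneg fun _ => sq_nonneg _
  have hC0 : 0 ≤ C := integral_nonneg fun _ => integral_nonneg fun _ => sq_nonneg _
  set F : Fin N → Fin N → (Fin N → α) → ℝ := fun k k' x => if k = k' then 0 else K (x k) (x k')
  have hFm : ∀ k k', Measurable (F k k') := by
    intro k k'
    by_cases h : k = k'
    · simp only [F, h, if_true]; fun_prop
    · simp only [F, h, if_false]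
      exact hK.comp (by fun_prop : Measurable fun x : Fin N → α => (x k, x k'))
  have hFb : ∀ k k' x, ‖F k k' x‖ ≤ B := by
    intro k k' x
    by_cases h : k = k'
    · simp only [F, h, if_true, norm_zero]; exact (abs_nonneg _).trans (hB (x k) (x k))
    · simp only [F, h, if_false]; exact hB _ _
  have hFi : ∀ k k' l l', Integrable (fun x => F k k' x * F l l' x)
      (Measure.pi fun _ : Fin N => μ) := fun k k' l l' =>
    integrable_of_bounded ((hFm k k').mul (hFm l l')) (B := B * B) fun x => by
      rw [norm_mul]
      exact mul_le_mul (hFb _ _ _) (hFb _ _ _) (norm_nonneg _) ((norm_nonneg _).trans (hFb k k' x))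
  let δ : Fin N → Fin N → ℝ := fun a b => if a = b then 1 else 0
  have hδ : ∀ a b, 0 ≤ δ a b := fun a b => by simp only [δ]; split_ifs <;> norm_num
  -- The covariance of two index pairs is controlled by their coincidences: a shared index costs
  -- `A`, a pair shared in either order costs `C`, and disjoint pairs are independent and centred.
  -- Summing the indicators gives `4 N³ A + 2 N² C`.
  have key : ∀ k k' l l', ∫ x, F k k' x * F l l' x ∂(Measure.pi fun _ : Fin N => μ) ≤
      A * (δ k l + δ k l' + δ k' l + δ k' l') + C * (δ k l * δ k' l' + δ k' l * δ k l') := by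
    intro k k' l l'
    have hR : 0 ≤ A * (δ k l + δ k l' + δ k' l + δ k' l') +
        C * (δ k l * δ k' l' + δ k' l * δ k l') := by
      have := hδ k l; have := hδ k l'; have := hδ k' l; have := hδ k' l'
      positivity
    by_cases h1 : k = k'
    · simpa [F, h1] using h1 ▸ hR
    by_cases h2 : l = l'
    · simpa [F, h2] using h2 ▸ hR
    have hF : (fun x => F k k' x * F l l' x) = fun x => K (x k) (x k') * K (x l) (x l') := by
      funext x; simp only [F, h1, h2, if_false]
    rw [hF]
    by_cases hkl : k = l
    · subst hkl
      by_cases hk'l' : k' = l'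
      · subst hk'l'
        rw [integral_kernel_sq hK hB h1]
        simp [δ, h1, Ne.symm h1]
        linarith
      · rw [integral_kernel_triple hK hB h1 h2 hk'l']
        simp [δ, h2, Ne.symm h1, hk'l', hA]
    by_cases hkl' : k = l'
    · subst hkl'
      have e : ∀ x : Fin N → α, K (x l) (x k) = K (x k) (x l) := fun x => hs _ _
      simp_rw [e]
      by_cases hk'l : k' = l
      · subst hk'l
        rw [integral_kernel_sq hK hB h1]
        simp [δ, h1, Ne.symm h1]
        linarith
      · rw [integral_kernel_triple hK hB h1 hkl hk'l]
        simp [δ, hkl, Ne.symm h1, hk'l, hA]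
    have e : ∀ x : Fin N → α, K (x k) (x k') = K (x k') (x k) := fun x => hs _ _
    by_cases hk'l : k' = l
    · subst hk'l
      simp_rw [e]
      rw [integral_kernel_triple hK hB (Ne.symm h1) h2 hkl']
      simp [δ, h1, hkl', h2, hA]
    by_cases hk'l' : k' = l'
    · subst hk'l'
      have e' : ∀ x : Fin N → α, K (x l) (x k') = K (x k') (x l) := fun x => hs _ _
      simp_rw [e, e']
      rw [integral_kernel_triple hK hB (Ne.symm h1) hk'l hkl]
      simp [δ, h1, hkl, hk'l, hA]
    rw [integral_kernel_disjoint hK hB h0 h1 hkl hkl' hk'l hk'l']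
    exact hR
  have hexp : ∀ x : Fin N → α, (∑ k, ∑ k', F k k' x) ^ 2 =
      ∑ k, ∑ k', ∑ l, ∑ l', F k k' x * F l l' x := by
    intro x
    rw [pow_two, Finset.sum_mul]
    refine Finset.sum_congr rfl fun k _ => ?_
    rw [Finset.sum_mul]
    refine Finset.sum_congr rfl fun k' _ => ?_
    rw [Finset.mul_sum]
    exact Finset.sum_congr rfl fun l _ => Finset.mul_sum _ _ _
  have hint : ∫ x, (∑ k, ∑ k', F k k' x) ^ 2 ∂(Measure.pi fun _ : Fin N => μ) =
      ∑ k, ∑ k', ∑ l, ∑ l', ∫ x, F k k' x * F l l' x ∂(Measure.pi fun _ : Fin N => μ) := by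
    simp_rw [hexp]
    rw [integral_finsetSum _ fun k _ => integrable_finsetSum _ fun k' _ =>
      integrable_finsetSum _ fun l _ => integrable_finsetSum _ fun l' _ => hFi k k' l l']
    refine Finset.sum_congr rfl fun k _ => ?_
    rw [integral_finsetSum _ fun k' _ =>
      integrable_finsetSum _ fun l _ => integrable_finsetSum _ fun l' _ => hFi k k' l l']
    refine Finset.sum_congr rfl fun k' _ => ?_
    rw [integral_finsetSum _ fun l _ => integrable_finsetSum _ fun l' _ => hFi k k' l l']
    refine Finset.sum_congr rfl fun l _ => ?_
    rw [integral_finsetSum _ fun l' _ => hFi k k' l l']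
  refine hint.trans_le ((Finset.sum_le_sum fun k _ => Finset.sum_le_sum fun k' _ =>
    Finset.sum_le_sum fun l _ => Finset.sum_le_sum fun l' _ => key k k' l l').trans_eq ?_)
  simp only [δ, mul_add, Finset.sum_add_distrib, mul_ite, mul_one, mul_zero, Finset.sum_ite_eq,
    Finset.mem_univ, if_true, Finset.sum_const, Finset.card_univ, Fintype.card_fin, nsmul_eq_mul]
  ring

theorem integral_sub_const_mul_add {f g : α → ℝ} (hf : Integrable f μ) (hg : Integrable g μ)
    (a b : ℝ) : ∫ x, (f x - a * g x + b) ∂μ = ∫ x, f x ∂μ - a * ∫ x, g x ∂μ + b := by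
  have h1 : Integrable (fun x => f x - a * g x) μ := hf.sub (hg.const_mul a)
  rw [integral_add h1 (integrable_const _), integral_sub hf (hg.const_mul a), integral_const_mul]
  simp

/-- The variance of a `U`-statistic of order two. -/
theorem integral_sq_offDiag_sub_le (hK : Measurable (Function.uncurry K))
    (hs : ∀ x y, K x y = K y x) {B : ℝ} (hB : ∀ x y, |K x y| ≤ B) :
    ∫ x : Fin N → α, ((∑ k, ∑ k', if k = k' then 0 else K (x k) (x k')) -
        N * (N - 1) * ∫ x, ∫ y, K x y ∂μ ∂μ) ^ 2 ∂(Measure.pi fun _ => μ) ≤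
    4 * N ^ 3 * ∫ x, (∫ y, K x y ∂μ) ^ 2 ∂μ + 2 * N ^ 2 * ∫ x, ∫ y, K x y ^ 2 ∂μ ∂μ := by
  set c := ∫ x, ∫ y, K x y ∂μ ∂μ with hc
  have hKx : ∀ x, Measurable (K x) := fun x => hK.of_uncurry_left
  have hKi : ∀ x, Integrable (K x) μ := fun x => integrable_of_bounded (hKx x) (hB x)
  have hK1m : Measurable fun x => ∫ y, K x y ∂μ :=
    (hK.stronglyMeasurable.integral_prod_right').measurable
  have hK1b : ∀ x, ‖∫ y, K x y ∂μ‖ ≤ B := fun x => by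
    refine (norm_integral_le_of_norm_le_const (ae_of_all _ (hB x))).trans ?_
    simp
  have hK1i : Integrable (fun x => ∫ y, K x y ∂μ) μ := integrable_of_bounded hK1m hK1b
  have hK2b : ∀ x y, ‖K x y ^ 2‖ ≤ B ^ 2 := fun x y => by
    rw [norm_pow]; gcongr; exact hB x y
  have hK2i : ∀ x, Integrable (fun y => K x y ^ 2) μ := fun x =>
    integrable_of_bounded ((hKx x).pow_const 2) (hK2b x)
  have hK2m : Measurable fun x => ∫ y, K x y ^ 2 ∂μ :=
    ((hK.pow_const 2).stronglyMeasurable.integral_prod_right').measurable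
  have hK2i' : Integrable (fun x => ∫ y, K x y ^ 2 ∂μ) μ :=
    integrable_of_bounded hK2m (B := B ^ 2) fun x => by
      refine (norm_integral_le_of_norm_le_const (ae_of_all _ (hK2b x))).trans ?_
      simp
  have e1 : ∀ x, ∫ y, (K x y - c) ∂μ = (∫ y, K x y ∂μ) - c := fun x => by
    rw [integral_sub (hKi x) (integrable_const _)]; simp
  have e1' : ∀ x, ∫ y, (K x y - c) ^ 2 ∂μ =
      (∫ y, K x y ^ 2 ∂μ) - 2 * c * (∫ y, K x y ∂μ) + c ^ 2 := fun x => by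
    have : ∀ y, (K x y - c) ^ 2 = K x y ^ 2 - 2 * c * K x y + c ^ 2 := fun y => by ring
    simp_rw [this]
    exact integral_sub_const_mul_add (hK2i x) (hKi x) _ _
  have h := integral_sq_offDiag_le_of_centered (μ := μ) (N := N) (K := fun x y => K x y - c)
    (B := B + |c|) (hK.sub_const c) (fun x y => by rw [hs x y])
    (fun x y => (abs_sub _ _).trans (by gcongr; exact hB x y)) (by
      simp_rw [e1]
      rw [integral_sub hK1i (integrable_const _)]; simp [hc])
  have hsum : ∀ x : Fin N → α, (∑ k, ∑ k', if k = k' then 0 else (K (x k) (x k') - c)) =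
      (∑ k, ∑ k', if k = k' then 0 else K (x k) (x k')) - N * (N - 1) * c := by
    intro x
    have : ∀ k k', (if k = k' then 0 else (K (x k) (x k') - c)) =
        (if k = k' then 0 else K (x k) (x k')) - (c - if k = k' then c else 0) := by
      intro k k'; split_ifs <;> simp
    simp_rw [this, Finset.sum_sub_distrib]
    simp
    ring
  simp_rw [hsum, e1, e1'] at h
  refine h.trans ?_
  -- Subtracting the mean does not increase a second moment; this holds for the projection here and
  -- for the full kernel in `e3`.
  have e2 : ∫ x, ((∫ y, K x y ∂μ) - c) ^ 2 ∂μ ≤ ∫ x, (∫ y, K x y ∂μ) ^ 2 ∂μ := by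
    have hsq : Integrable (fun x => (∫ y, K x y ∂μ) ^ 2) μ :=
      integrable_of_bounded (hK1m.pow_const 2) (B := B ^ 2) fun x => by
        rw [norm_pow]; gcongr; exact hK1b x
    have : ∀ x, ((∫ y, K x y ∂μ) - c) ^ 2 =
        (∫ y, K x y ∂μ) ^ 2 - 2 * c * (∫ y, K x y ∂μ) + c ^ 2 := fun y => by ring
    simp_rw [this]
    rw [integral_sub_const_mul_add hsq hK1i, ← hc]
    nlinarith [sq_nonneg c]
  have e3 : ∫ x, ((∫ y, K x y ^ 2 ∂μ) - 2 * c * (∫ y, K x y ∂μ) + c ^ 2) ∂μ ≤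
      ∫ x, ∫ y, K x y ^ 2 ∂μ ∂μ := by
    rw [integral_sub_const_mul_add hK2i' hK1i, ← hc]
    nlinarith [sq_nonneg c]
  gcongr

end UStatistic


/-! ### Row and column correlations of a kernel matrix -/

/-- The `T* T` identity: expand the square and apply Fubini, so that an estimate for an integral
operator becomes one for the correlations of its kernel in the output variable `y`. -/
theorem integral_norm_sq_integral {γ δ : Type*} [MeasurableSpace γ] [MeasurableSpace δ]
    (σ : Measure γ) (τ : Measure δ) [IsProbabilityMeasure σ] [IsProbabilityMeasure τ]
    {a : γ → δ → ℂ} (ha : Measurable (Function.uncurry a)) {B : ℝ} (hB : ∀ x y, ‖a x y‖ ≤ B) :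
    ∫ y, ‖∫ x, a x y ∂σ‖ ^ 2 ∂τ =
      ∫ x, ∫ x', (∫ y, a x y * (starRingEnd ℂ) (a x' y) ∂τ).re ∂σ ∂σ := by
  have hcomp : ∀ {ι : Type _} [MeasurableSpace ι] {f : ι → γ} {g : ι → δ}, Measurable f →
      Measurable g → Measurable fun i => a (f i) (g i) := fun hf hg => ha.comp (hf.prodMk hg)
  have hm : Measurable fun p : (γ × γ) × δ => a p.1.1 p.2 * (starRingEnd ℂ) (a p.1.2 p.2) :=
    (hcomp (by fun_prop) (by fun_prop)).mul
      (Complex.continuous_conj.measurable.comp (hcomp (by fun_prop) (by fun_prop)))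
  have hb : ∀ x x' y, ‖a x y * (starRingEnd ℂ) (a x' y)‖ ≤ B * B := fun x x' y => by
    rw [norm_mul, RCLike.norm_conj]
    exact mul_le_mul (hB _ _) (hB _ _) (norm_nonneg _) ((norm_nonneg _).trans (hB x y))
  have hi : Integrable (fun p : (γ × γ) × δ => a p.1.1 p.2 * (starRingEnd ℂ) (a p.1.2 p.2))
      ((σ.prod σ).prod τ) := integrable_of_bounded hm fun p => hb _ _ _
  have hi2 : ∀ y, Integrable (fun p : γ × γ => a p.1 y * (starRingEnd ℂ) (a p.2 y))
      (σ.prod σ) := fun y => integrable_of_bounded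
    (hm.comp (by fun_prop : Measurable fun p : γ × γ => (p, y))) fun p => hb _ _ _
  have h1 : ∀ y, ‖∫ x, a x y ∂σ‖ ^ 2 =
      ∫ p : γ × γ, (a p.1 y * (starRingEnd ℂ) (a p.2 y)).re ∂(σ.prod σ) := by
    intro y
    have e := integral_re (𝕜 := ℂ) (hi2 y)
    simp only [RCLike.re_to_complex] at e
    rw [e, integral_prod_mul (fun x => a x y) (fun x => (starRingEnd ℂ) (a x y)), integral_conj,
      Complex.mul_conj, Complex.ofReal_re, Complex.sq_norm]
  have hir : Integrable (fun p : (γ × γ) × δ =>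
      (a p.1.1 p.2 * (starRingEnd ℂ) (a p.1.2 p.2)).re) ((σ.prod σ).prod τ) := hi.re
  simp_rw [h1]
  rw [← integral_integral_swap (f := fun (p : γ × γ) y =>
    (a p.1 y * (starRingEnd ℂ) (a p.2 y)).re) hir, integral_prod _ hir.integral_prod_left]
  refine integral_congr_ae (ae_of_all _ fun x => integral_congr_ae (ae_of_all _ fun x' => ?_))
  exact integral_re (𝕜 := ℂ) (integrable_of_bounded
    (hm.comp (by fun_prop : Measurable fun y : δ => ((x, x'), y))) fun y => hb _ _ _)

theorem sq_integral_le_integral_sq {γ : Type*} [MeasurableSpace γ] (σ : Measure γ)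
    [IsProbabilityMeasure σ] {f : γ → ℝ} (hf : Measurable f) {B : ℝ} (hB : ∀ x, |f x| ≤ B) :
    (∫ x, f x ∂σ) ^ 2 ≤ ∫ x, f x ^ 2 ∂σ := by
  have h1 : Integrable f σ := integrable_of_bounded hf hB
  have h2 : Integrable (fun x => f x ^ 2) σ :=
    integrable_of_bounded (hf.pow_const 2) (B := B ^ 2) fun x => by
      rw [norm_pow]; gcongr; exact hB x
  have h := integral_sub_const_mul_add (μ := σ) h2 h1 (2 * ∫ x, f x ∂σ) ((∫ x, f x ∂σ) ^ 2)
  have h3 : 0 ≤ ∫ x, (f x ^ 2 - 2 * (∫ x, f x ∂σ) * f x + (∫ x, f x ∂σ) ^ 2) ∂σ :=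
    integral_nonneg fun x => by
      have : 0 ≤ (f x - ∫ x, f x ∂σ) ^ 2 := sq_nonneg _
      simp only [Pi.zero_apply]
      linarith
  nlinarith

section RandomMatrix

set_option linter.unusedSectionVars false

variable {α β : Type*} [MeasurableSpace α] [MeasurableSpace β]

/-- The averaged correlation of the rows indexed by `r` and `r'`. -/
noncomputable def rowCorr (μ : Measure α) (h : β → α → ℂ) (r r' : β) : ℂ :=
  ∫ t, h r t * (starRingEnd ℂ) (h r' t) ∂μ

/-- The squared modulus of the averaged correlation of the rows indexed by `r` and `r'`. -/
noncomputable def rowCorrSq (μ : Measure α) (h : β → α → ℂ) (r r' : β) : ℝ :=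
  ‖rowCorr μ h r r'‖ ^ 2

/-- The squared correlation of the columns indexed by `t` and `t'`. -/
noncomputable def colCorrSq {N : ℕ} (h : β → α → ℂ) (r : Fin N → β) (t t' : α) : ℝ :=
  ‖∑ i, h (r i) t * (starRingEnd ℂ) (h (r i) t')‖ ^ 2

/-- The kernel whose double sum over the rows is the average of `colCorrSq h r t`. -/
noncomputable def pairKernel (μ : Measure α) (h : β → α → ℂ) (t : α) (r r' : β) : ℝ :=
  (h r t * (starRingEnd ℂ) (h r' t) * (starRingEnd ℂ) (rowCorr μ h r r')).re

variable {μ : Measure α} {ν : Measure β} [IsProbabilityMeasure μ] [IsProbabilityMeasure ν]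
  {h : β → α → ℂ} {N : ℕ}

theorem measurable_comp₂ (hh : Measurable (Function.uncurry h)) {ι : Type*} [MeasurableSpace ι]
    {f : ι → β} {g : ι → α} (hf : Measurable f) (hg : Measurable g) :
    Measurable fun i => h (f i) (g i) := hh.comp (hf.prodMk hg)

theorem norm_mul_conj_le (hb : ∀ r t, ‖h r t‖ ≤ 2) (r r' : β) (t t' : α) :
    ‖h r t * (starRingEnd ℂ) (h r' t')‖ ≤ 4 := by
  rw [norm_mul, RCLike.norm_conj]
  nlinarith [hb r t, hb r' t', norm_nonneg (h r t), norm_nonneg (h r' t')]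

theorem norm_rowCorr_le (hb : ∀ r t, ‖h r t‖ ≤ 2) (r r' : β) : ‖rowCorr μ h r r'‖ ≤ 4 := by
  refine (norm_integral_le_of_norm_le_const
    (ae_of_all _ fun t => norm_mul_conj_le hb r r' t t)).trans ?_
  simp

theorem rowCorr_swap (r r' : β) : rowCorr μ h r' r = (starRingEnd ℂ) (rowCorr μ h r r') := by
  rw [rowCorr, rowCorr, ← integral_conj]
  simp [mul_comm]

theorem measurable_rowCorr (hh : Measurable (Function.uncurry h)) :
    Measurable fun p : β × β => rowCorr μ h p.1 p.2 := by
  have : Measurable fun q : (β × β) × α => h q.1.1 q.2 * (starRingEnd ℂ) (h q.1.2 q.2) :=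
    (measurable_comp₂ hh (by fun_prop) (by fun_prop)).mul
      (Complex.continuous_conj.measurable.comp (measurable_comp₂ hh (by fun_prop) (by fun_prop)))
  exact (this.stronglyMeasurable.integral_prod_right' (ν := μ)).measurable

theorem measurable_pairKernel (hh : Measurable (Function.uncurry h)) :
    Measurable fun p : α × β × β => pairKernel μ h p.1 p.2.1 p.2.2 := by
  refine Complex.measurable_re.comp (((measurable_comp₂ hh (by fun_prop) (by fun_prop)).mul
    (Complex.continuous_conj.measurable.comp
      (measurable_comp₂ hh (by fun_prop) (by fun_prop)))).mul
    (Complex.continuous_conj.measurable.comp ((measurable_rowCorr hh).comp (by fun_prop))))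

theorem pairKernel_swap (t : α) (r r' : β) : pairKernel μ h t r r' = pairKernel μ h t r' r := by
  rw [pairKernel, pairKernel, rowCorr_swap r r', ← Complex.conj_re]
  simp only [map_mul, Complex.conj_conj]
  ring_nf

theorem abs_pairKernel_le (hb : ∀ r t, ‖h r t‖ ≤ 2) (t : α) (r r' : β) :
    |pairKernel μ h t r r'| ≤ 4 * ‖rowCorr μ h r r'‖ := by
  refine (Complex.abs_re_le_norm _).trans ?_
  rw [norm_mul, RCLike.norm_conj]
  gcongr
  exact norm_mul_conj_le hb r r' t t

theorem abs_pairKernel_le' (hb : ∀ r t, ‖h r t‖ ≤ 2) (t : α) (r r' : β) :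
    |pairKernel μ h t r r'| ≤ 16 :=
  (abs_pairKernel_le hb t r r').trans (by linarith [norm_rowCorr_le (μ := μ) hb r r'])

theorem colCorrSq_le (hb : ∀ r t, ‖h r t‖ ≤ 2) (r : Fin N → β) (t t' : α) :
    colCorrSq h r t t' ≤ 16 * N ^ 2 := by
  have : ‖∑ i, h (r i) t * (starRingEnd ℂ) (h (r i) t')‖ ≤ 4 * N := by
    refine (norm_sum_le_of_le _ fun i _ => norm_mul_conj_le hb (r i) (r i) t t').trans ?_
    simp [mul_comm]
  calc colCorrSq h r t t' ≤ (4 * N) ^ 2 := by unfold colCorrSq; gcongr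
    _ = 16 * N ^ 2 := by ring

theorem abs_colCorrSq_le (hb : ∀ r t, ‖h r t‖ ≤ 2) (r : Fin N → β) (t t' : α) :
    |colCorrSq h r t t'| ≤ 16 * N ^ 2 := by
  rw [abs_of_nonneg (sq_nonneg _)]; exact colCorrSq_le hb r t t'

theorem measurable_colCorrSq (hh : Measurable (Function.uncurry h)) :
    Measurable fun p : (Fin N → β) × α × α => colCorrSq h p.1 p.2.1 p.2.2 := by
  refine Measurable.pow_const (Measurable.norm (Finset.measurable_sum _ fun i _ => ?_)) 2
  exact (measurable_comp₂ hh (by fun_prop) (by fun_prop)).mul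
      (Complex.continuous_conj.measurable.comp (measurable_comp₂ hh (by fun_prop) (by fun_prop)))

theorem colCorrSq_swap (r : Fin N → β) (t t' : α) : colCorrSq h r t t' = colCorrSq h r t' t := by
  rw [colCorrSq, colCorrSq, ← RCLike.norm_conj, map_sum]
  simp [mul_comm]

theorem integrable_mul_conj (hh : Measurable (Function.uncurry h)) (hb : ∀ r t, ‖h r t‖ ≤ 2)
    (r r' : β) : Integrable (fun t => h r t * (starRingEnd ℂ) (h r' t)) μ :=
  integrable_of_bounded ((measurable_comp₂ hh measurable_const measurable_id).mul
    (Complex.continuous_conj.measurable.comp (measurable_comp₂ hh measurable_const measurable_id)))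
    fun t => norm_mul_conj_le hb r r' t t

/-- Expand the square over pairs of rows; averaging over `t'` turns the factor in `t'` into a
`rowCorr`. The first projection of the column statistic is thus itself a double sum over the rows.
-/
theorem integral_colCorrSq (hh : Measurable (Function.uncurry h)) (hb : ∀ r t, ‖h r t‖ ≤ 2)
    (r : Fin N → β) (t : α) :
    ∫ t', colCorrSq h r t t' ∂μ = ∑ i, ∑ i', pairKernel μ h t (r i) (r i') := by
  have hexp : ∀ t', colCorrSq h r t t' = ∑ i, ∑ i',
      ((h (r i) t * (starRingEnd ℂ) (h (r i') t)) *
        (h (r i') t' * (starRingEnd ℂ) (h (r i) t'))).re := by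
    intro t'
    have : ((colCorrSq h r t t' : ℝ) : ℂ) = ∑ i, ∑ i',
      ((h (r i) t * (starRingEnd ℂ) (h (r i') t)) *
        (h (r i') t' * (starRingEnd ℂ) (h (r i) t'))) := by
      rw [colCorrSq, Complex.sq_norm, ← Complex.mul_conj, map_sum, Finset.sum_mul_sum]
      refine Finset.sum_congr rfl fun i _ => Finset.sum_congr rfl fun i' _ => ?_
      simp only [map_mul, Complex.conj_conj]
      ring
    rw [← Complex.ofReal_re (colCorrSq h r t t'), this, Complex.re_sum]
    exact Finset.sum_congr rfl fun i _ => Complex.re_sum _ _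
  have hi : ∀ i i', Integrable (fun t' => (h (r i) t * (starRingEnd ℂ) (h (r i') t)) *
        (h (r i') t' * (starRingEnd ℂ) (h (r i) t'))) μ := fun i i' =>
    (integrable_mul_conj hh hb (r i') (r i)).const_mul _
  have hre : ∀ i i', Integrable (fun t' => ((h (r i) t * (starRingEnd ℂ) (h (r i') t)) *
        (h (r i') t' * (starRingEnd ℂ) (h (r i) t'))).re) μ := fun i i' => (hi i i').re
  simp_rw [hexp]
  rw [integral_finsetSum _ fun i _ => integrable_finsetSum _ fun i' _ => hre i i']
  refine Finset.sum_congr rfl fun i _ => ?_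
  rw [integral_finsetSum _ fun i' _ => hre i i']
  refine Finset.sum_congr rfl fun i' _ => (integral_re (𝕜 := ℂ) (hi i i')).trans ?_
  rw [integral_const_mul, pairKernel, ← rowCorr_swap (r i) (r i')]
  rfl

theorem integral_pairKernel (hh : Measurable (Function.uncurry h)) (hb : ∀ r t, ‖h r t‖ ≤ 2)
    (r r' : β) : ∫ t, pairKernel μ h t r r' ∂μ = rowCorrSq μ h r r' := by
  refine (integral_re (𝕜 := ℂ) ((integrable_mul_conj hh hb r r').mul_const _)).trans ?_
  rw [integral_mul_const, RCLike.re_to_complex]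
  rw [show ∫ t, h r t * (starRingEnd ℂ) (h r' t) ∂μ = rowCorr μ h r r' from rfl, Complex.mul_conj,
    Complex.ofReal_re, rowCorrSq, Complex.sq_norm]

/-- The averaged form of `tr (Hᴴ H)² = tr (H Hᴴ)²`: the mean over columns is a double sum over rows,
to which the variance bound applies a second time. -/
theorem integral_integral_colCorrSq (hh : Measurable (Function.uncurry h))
    (hb : ∀ r t, ‖h r t‖ ≤ 2) (r : Fin N → β) :
    ∫ t, ∫ t', colCorrSq h r t t' ∂μ ∂μ = ∑ i, ∑ i', rowCorrSq μ h (r i) (r i') := by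
  have hi : ∀ i i', Integrable (fun t => pairKernel μ h t (r i) (r i')) μ := fun i i' =>
    integrable_of_bounded ((measurable_pairKernel hh).comp
      (by fun_prop : Measurable fun t : α => (t, r i, r i'))) fun t => abs_pairKernel_le' hb _ _ _
  simp_rw [integral_colCorrSq hh hb]
  rw [integral_finsetSum _ fun i _ => integrable_finsetSum _ fun i' _ => hi i i']
  refine Finset.sum_congr rfl fun i _ => ?_
  rw [integral_finsetSum _ fun i' _ => hi i i']
  exact Finset.sum_congr rfl fun i' _ => integral_pairKernel hh hb _ _

/-- Identifies the mean of the pair kernel with the quantity that the column hypothesis bounds by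
`ε`, and shows that it is nonnegative. -/
theorem integral_integral_pairKernel (hh : Measurable (Function.uncurry h))
    (hb : ∀ r t, ‖h r t‖ ≤ 2) (t : α) :
    ∫ r, ∫ r', pairKernel μ h t r r' ∂ν ∂ν =
      ∫ t', ‖∫ r, h r t * (starRingEnd ℂ) (h r t') ∂ν‖ ^ 2 ∂μ := by
  have hm : Measurable (Function.uncurry fun (r : β) (t' : α) =>
      h r t * (starRingEnd ℂ) (h r t')) :=
    (measurable_comp₂ hh (by fun_prop) (by fun_prop)).mul
      (Complex.continuous_conj.measurable.comp (measurable_comp₂ hh (by fun_prop) (by fun_prop)))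
  rw [integral_norm_sq_integral ν μ hm fun r t' => norm_mul_conj_le hb r r t t']
  refine integral_congr_ae (ae_of_all _ fun r => integral_congr_ae (ae_of_all _ fun r' => ?_))
  simp only
  rw [pairKernel, ← rowCorr_swap r r', rowCorr, ← integral_const_mul]
  congr 1
  refine integral_congr_ae (ae_of_all _ fun t' => ?_)
  simp only [map_mul, Complex.conj_conj]
  ring

attribute [irreducible] rowCorr rowCorrSq colCorrSq pairKernel

end RandomMatrix


/-! ### Concentration of the fourth Schatten moment -/

section RandomMatrixMoments

set_option linter.unusedSectionVars false

variable {α β : Type*} [MeasurableSpace α] [MeasurableSpace β] {μ : Measure α} {ν : Measure β}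
  [IsProbabilityMeasure μ] [IsProbabilityMeasure ν] {h : β → α → ℂ} {N : ℕ} {ε : ℝ}

theorem abs_sum_diag_le {γ : Type*} {K : γ → γ → ℝ} {B : ℝ} (hB : ∀ x y, |K x y| ≤ B)
    (x : Fin N → γ) :
    |(∑ k, ∑ k', K (x k) (x k')) - ∑ k, ∑ k', if k = k' then 0 else K (x k) (x k')| ≤ B * N := by
  have e : (∑ k, ∑ k', K (x k) (x k')) - (∑ k, ∑ k', if k = k' then 0 else K (x k) (x k')) =
      ∑ k, K (x k) (x k) := by
    rw [← Finset.sum_sub_distrib]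
    refine Finset.sum_congr rfl fun k _ => ?_
    rw [← Finset.sum_sub_distrib, Finset.sum_eq_single_of_mem k (Finset.mem_univ _)]
    · simp
    · intro k' _ hk'
      simp [Ne.symm hk']
  rw [e, ← Real.norm_eq_abs]
  refine (norm_sum_le_of_le _ fun k _ => hB (x k) (x k)).trans ?_
  simp [mul_comm]

theorem measurable_sum_offDiag {γ : Type*} [MeasurableSpace γ] {K : γ → γ → ℝ}
    (hK : Measurable (Function.uncurry K)) :
    Measurable fun x : Fin N → γ => ∑ k, ∑ k', if k = k' then 0 else K (x k) (x k') := by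
  refine Finset.measurable_sum _ fun k _ => Finset.measurable_sum _ fun k' _ => ?_
  split_ifs
  · fun_prop
  · exact hK.comp (by fun_prop : Measurable fun x : Fin N → γ => (x k, x k'))

theorem abs_sum_offDiag_le {γ : Type*} {K : γ → γ → ℝ} {B : ℝ} (hB : ∀ x y, |K x y| ≤ B)
    (x : Fin N → γ) :
    |∑ k, ∑ k', if k = k' then 0 else K (x k) (x k')| ≤ N * (N * B) := by
  rw [← Real.norm_eq_abs]
  refine (norm_sum_le_of_le _ fun k _ => norm_sum_le_of_le (f := fun k' =>
    if k = k' then 0 else K (x k) (x k')) (n := fun _ => B) _ fun k' _ => ?_).trans ?_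
  · split_ifs
    · simpa using (abs_nonneg _).trans (hB (x k) (x k))
    · exact hB _ _
  · simp

theorem mul_sub_one_nonneg (N : ℕ) : (0 : ℝ) ≤ N * (N - 1) := by
  rcases Nat.eq_zero_or_pos N with h | h
  · simp [h]
  · have : (1 : ℝ) ≤ N := by exact_mod_cast h
    nlinarith

theorem rowCorrSq_nonneg (μ : Measure α) (h : β → α → ℂ) (r r' : β) : 0 ≤ rowCorrSq μ h r r' := by
  rw [rowCorrSq]
  exact sq_nonneg _

theorem colCorrSq_nonneg (h : β → α → ℂ) (r : Fin N → β) (t t' : α) : 0 ≤ colCorrSq h r t t' := by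
  rw [colCorrSq]
  exact sq_nonneg _

theorem measurable_rowCorr_sq (hh : Measurable (Function.uncurry h)) :
    Measurable (Function.uncurry (rowCorrSq μ h)) := by
  have : Function.uncurry (rowCorrSq μ h) = fun p => ‖rowCorr μ h p.1 p.2‖ ^ 2 := by
    funext p
    rw [Function.uncurry, rowCorrSq]
  rw [this]
  exact (measurable_rowCorr hh).norm.pow_const 2

theorem measurable_rowCorrSq_comp (hh : Measurable (Function.uncurry h)) {ι : Type*}
    [MeasurableSpace ι] {f g : ι → β} (hf : Measurable f) (hg : Measurable g) :
    Measurable fun x => rowCorrSq μ h (f x) (g x) :=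
  (measurable_rowCorr_sq (μ := μ) hh).comp (hf.prodMk hg)

theorem measurable_colCorrSq_comp (hh : Measurable (Function.uncurry h)) {ι : Type*}
    [MeasurableSpace ι] {f : ι → Fin N → β} {g g' : ι → α} (hf : Measurable f)
    (hg : Measurable g) (hg' : Measurable g') :
    Measurable fun x => colCorrSq h (f x) (g x) (g' x) :=
  (measurable_colCorrSq hh).comp (hf.prodMk (hg.prodMk hg'))

theorem integral_rowCorrSq_le
    (hrow : ∀ r, ∫ r', ‖∫ t, h r t * (starRingEnd ℂ) (h r' t) ∂μ‖ ^ 2 ∂ν ≤ ε) (r : β) :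
    ∫ r', rowCorrSq μ h r r' ∂ν ≤ ε := by
  simpa only [rowCorrSq, rowCorr] using hrow r

theorem integral_integral_rowCorr_le
    (hrow : ∀ r, ∫ r', ‖∫ t, h r t * (starRingEnd ℂ) (h r' t) ∂μ‖ ^ 2 ∂ν ≤ ε) :
    ∫ r, ∫ r', rowCorrSq μ h r r' ∂ν ∂ν ≤ ε := by
  refine (integral_mono_of_nonneg (ae_of_all _ fun r => integral_nonneg fun r' =>
    rowCorrSq_nonneg _ _ _ _)
    (integrable_const ε) (ae_of_all _ (integral_rowCorrSq_le hrow))).trans ?_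
  simp

/-- The double sum splits into a diagonal of size `16 N`, a mean of at most `N² ε`, and a
U-statistic fluctuation. The kernel satisfies `|pairKernel| ≤ 4 ‖rowCorr‖`, so its second moments
are at most `16 ε` and the fluctuation has order `N³ ε`, a cross term of `(N + N² ε)²`. -/
theorem integral_sq_sum_pairKernel_le (hh : Measurable (Function.uncurry h))
    (hb : ∀ r t, ‖h r t‖ ≤ 2) (hε : 0 ≤ ε)
    (hcol : ∀ t, ∫ t', ‖∫ r, h r t * (starRingEnd ℂ) (h r t') ∂ν‖ ^ 2 ∂μ ≤ ε)
    (hrow : ∀ r, ∫ r', ‖∫ t, h r t * (starRingEnd ℂ) (h r' t) ∂μ‖ ^ 2 ∂ν ≤ ε) (t : α) :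
    ∫ r : Fin N → β, (∑ i, ∑ i', pairKernel μ h t (r i) (r i')) ^ 2 ∂(Measure.pi fun _ => ν) ≤
      768 * (N + N ^ 2 * ε) ^ 2 := by
  have hK : Measurable (Function.uncurry (pairKernel μ h t)) :=
    (measurable_pairKernel hh).comp (by fun_prop : Measurable fun p : β × β => (t, p.1, p.2))
  have hKb := abs_pairKernel_le' (μ := μ) hb t
  have hvar := integral_sq_offDiag_sub_le (μ := ν) (N := N) hK (pairKernel_swap t) hKb
  set c := ∫ r, ∫ r', pairKernel μ h t r r' ∂ν ∂ν with hc
  have hc0 : 0 ≤ c := by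
    rw [hc, integral_integral_pairKernel (μ := μ) hh hb t]
    exact integral_nonneg fun _ => sq_nonneg _
  have hcε : c ≤ ε := by
    rw [hc, integral_integral_pairKernel (μ := μ) hh hb t]
    exact hcol t
  have hQm : ∀ r, Measurable fun r' => rowCorrSq μ h r r' := fun r =>
    measurable_rowCorrSq_comp hh (by fun_prop) (by fun_prop)
  have hQi : ∀ r, Integrable (fun r' => rowCorrSq μ h r r') ν := fun r =>
    integrable_of_bounded (hQm r) (B := 16) fun r' => by
      rw [rowCorrSq, norm_pow, norm_norm]
      nlinarith [norm_rowCorr_le (μ := μ) hb r r', norm_nonneg (rowCorr μ h r r')]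
  have hsq : ∀ r, ∫ r', pairKernel μ h t r r' ^ 2 ∂ν ≤ 16 * ε := fun r => by
    refine (integral_mono_of_nonneg (ae_of_all _ fun r' => sq_nonneg _) ((hQi r).const_mul 16)
      (ae_of_all _ fun r' => ?_)).trans ?_
    · have := abs_pairKernel_le (μ := μ) hb t r r'
      simp only
      rw [← sq_abs, rowCorrSq]
      nlinarith [abs_nonneg (pairKernel μ h t r r')]
    · rw [integral_const_mul]
      have := hrow r
      simp only [rowCorrSq, rowCorr]
      linarith
  have hE2 : ∫ r, ∫ r', pairKernel μ h t r r' ^ 2 ∂ν ∂ν ≤ 16 * ε := by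
    refine (integral_mono_of_nonneg (ae_of_all _ fun r => integral_nonneg fun r' => sq_nonneg _)
      (integrable_const (16 * ε)) (ae_of_all _ hsq)).trans ?_
    simp
  have hE1 : ∫ r, (∫ r', pairKernel μ h t r r' ∂ν) ^ 2 ∂ν ≤ 16 * ε := by
    refine (integral_mono_of_nonneg (ae_of_all _ fun r => sq_nonneg _)
      (integrable_const (16 * ε)) (ae_of_all _ fun r => ?_)).trans (by simp)
    exact (sq_integral_le_integral_sq ν hK.of_uncurry_left (hKb r)).trans (hsq r)
  set S : (Fin N → β) → ℝ := fun r => ∑ i, ∑ i', if i = i' then 0 else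
    pairKernel μ h t (r i) (r i') with hS
  have hSm : Measurable S := measurable_sum_offDiag hK
  have hSi : Integrable (fun r => (S r - N * (N - 1) * c) ^ 2) (Measure.pi fun _ : Fin N => ν) :=
    integrable_of_bounded ((hSm.sub_const _).pow_const 2)
      (B := (N * (N * 16) + |N * (N - 1) * c|) ^ 2) fun r => by
        rw [norm_pow]
        gcongr
        exact (abs_sub _ _).trans (by gcongr; exact abs_sum_offDiag_le hKb r)
  -- `(a + b + c)² ≤ 3 (a² + b² + c²)` for diagonal, fluctuation and mean; the diagonal produces the
  -- constant `3 · 16² = 768`.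
  have hpt : ∀ r : Fin N → β, (∑ i, ∑ i', pairKernel μ h t (r i) (r i')) ^ 2 ≤
      3 * (S r - N * (N - 1) * c) ^ 2 + 3 * ((16 * N) ^ 2 + (N * (N - 1) * c) ^ 2) := by
    intro r
    have hd := abs_sum_diag_le hKb r
    change |_ - S r| ≤ _ at hd
    set T := ∑ i, ∑ i', pairKernel μ h t (r i) (r i')
    have h1 : (T - S r) ^ 2 ≤ (16 * N) ^ 2 := by
      rw [← sq_abs]; gcongr
    nlinarith [sq_nonneg ((T - S r) - (S r - N * (N - 1) * c)),
      sq_nonneg ((T - S r) - (N * (N - 1) * c)),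
      sq_nonneg ((S r - N * (N - 1) * c) - (N * (N - 1) * c))]
  refine (integral_mono_of_nonneg (ae_of_all _ fun r => sq_nonneg _)
    ((hSi.const_mul 3).add (integrable_const _)) (ae_of_all _ hpt)).trans ?_
  have e := integral_add (hSi.const_mul 3)
    (integrable_const (μ := Measure.pi fun _ : Fin N => ν) (3 * ((16 * N) ^ 2 +
      (N * (N - 1) * c) ^ 2)))
  refine e.trans_le ?_
  rw [integral_const_mul]
  simp only [integral_const, probReal_univ, one_smul]
  have hN0 : (0 : ℝ) ≤ N := Nat.cast_nonneg N
  have hNN := mul_sub_one_nonneg N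
  have h2 : (N * (N - 1) * c : ℝ) ≤ N ^ 2 * ε := by
    calc (N * (N - 1) * c : ℝ) ≤ N * (N - 1) * ε := by gcongr
      _ ≤ N ^ 2 * ε := by
        gcongr
        nlinarith
  have h2' : (N * (N - 1) * c : ℝ) ^ 2 ≤ (N ^ 2 * ε) ^ 2 := by gcongr
  have h3 : (4 * N ^ 3 * ∫ r, (∫ r', pairKernel μ h t r r' ∂ν) ^ 2 ∂ν : ℝ) ≤
      4 * N ^ 3 * (16 * ε) := by gcongr
  have h4 : (2 * N ^ 2 * ∫ r, ∫ r', pairKernel μ h t r r' ^ 2 ∂ν ∂ν : ℝ) ≤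
      2 * N ^ 2 * (16 * ε) := by gcongr
  have h5 : (N : ℝ) ^ 2 * ε ≤ N ^ 3 * ε := by
    gcongr ?_ * ε
    rcases Nat.eq_zero_or_pos N with h | h
    · simp [h]
    · exact_mod_cast Nat.pow_le_pow_right h (by norm_num)
  have h6 : 0 ≤ (N : ℝ) ^ 3 * ε := by positivity
  nlinarith [sq_nonneg ((N : ℝ) ^ 2 * ε)]

theorem abs_rowCorr_sq_le (hb : ∀ r t, ‖h r t‖ ≤ 2) (r r' : β) :
    |rowCorrSq μ h r r'| ≤ 16 := by
  rw [rowCorrSq, abs_of_nonneg (sq_nonneg _)]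
  nlinarith [norm_rowCorr_le (μ := μ) hb r r', norm_nonneg (rowCorr μ h r r')]

theorem integral_sum_rowCorr_le (hh : Measurable (Function.uncurry h))
    (hb : ∀ r t, ‖h r t‖ ≤ 2) (hε : 0 ≤ ε)
    (hrow : ∀ r, ∫ r', ‖∫ t, h r t * (starRingEnd ℂ) (h r' t) ∂μ‖ ^ 2 ∂ν ≤ ε) :
    ∫ r : Fin N → β, ∑ i, ∑ i', rowCorrSq μ h (r i) (r i') ∂(Measure.pi fun _ => ν) ≤
      16 * N + N ^ 2 * ε := by
  have hQm := measurable_rowCorr_sq (μ := μ) hh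
  have hQb := abs_rowCorr_sq_le (μ := μ) hb
  have hi : ∀ i i', Integrable (fun r : Fin N → β => rowCorrSq μ h (r i) (r i'))
      (Measure.pi fun _ => ν) := fun i i' =>
    integrable_of_bounded (measurable_rowCorrSq_comp hh (by fun_prop) (by fun_prop))
      fun r => hQb (r i) (r i')
  rw [integral_finsetSum _ fun i _ => integrable_finsetSum _ fun i' _ => hi i i']
  simp_rw [integral_finsetSum _ fun i' _ => hi _ i']
  have h1 : ∀ i i' : Fin N, ∫ r : Fin N → β, rowCorrSq μ h (r i) (r i')
      ∂(Measure.pi fun _ => ν) ≤ (if i = i' then 16 else 0) + ε := by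
    intro i i'
    split_ifs with hii
    · refine (integral_mono (hi i i') (integrable_const 16) fun r =>
        (le_abs_self _).trans (hQb _ _)).trans ?_
      simpa using hε
    · rw [integral_kernel_pair hQm hQb hii, zero_add]
      exact integral_integral_rowCorr_le hrow
  refine (Finset.sum_le_sum fun i _ => Finset.sum_le_sum fun i' _ => h1 i i').trans_eq ?_
  simp only [Finset.sum_add_distrib, Finset.sum_ite_eq, Finset.mem_univ, if_true, Finset.sum_const,
    Finset.card_univ, Fintype.card_fin, nsmul_eq_mul]
  ring

/-- The fluctuation of the column sum around its mean over the column points. -/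
noncomputable def colFluct (μ : Measure α) (h : β → α → ℂ) (r : Fin N → β) (t : Fin N → α) : ℝ :=
  (∑ k, ∑ k', if k = k' then 0 else colCorrSq h r (t k) (t k')) -
    N * (N - 1) * ∑ i, ∑ i', rowCorrSq μ h (r i) (r i')

theorem measurable_colFluct (hh : Measurable (Function.uncurry h)) :
    Measurable fun p : (Fin N → α) × (Fin N → β) => colFluct μ h p.2 p.1 := by
  refine Measurable.sub ?_ (Measurable.const_mul ?_ _)
  · refine Finset.measurable_sum _ fun k _ => Finset.measurable_sum _ fun k' _ => ?_
    split_ifs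
    · fun_prop
    · exact measurable_colCorrSq_comp hh (by fun_prop) (by fun_prop) (by fun_prop)
  · refine Finset.measurable_sum _ fun i _ => Finset.measurable_sum _ fun i' _ => ?_
    exact measurable_rowCorrSq_comp hh (by fun_prop) (by fun_prop)

theorem abs_colFluct_le (hb : ∀ r t, ‖h r t‖ ≤ 2) (r : Fin N → β) (t : Fin N → α) :
    |colFluct μ h r t| ≤ N * (N * (16 * N ^ 2)) + N * (N - 1) * (N * (N * 16)) := by
  refine (abs_sub _ _).trans (add_le_add (abs_sum_offDiag_le (K := colCorrSq h r) (abs_colCorrSq_le hb r) t) ?_)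
  rw [abs_mul, abs_of_nonneg (mul_sub_one_nonneg N)]
  refine mul_le_mul_of_nonneg_left ?_ (mul_sub_one_nonneg N)
  rw [← Real.norm_eq_abs]
  refine (norm_sum_le_of_le _ fun i _ => norm_sum_le_of_le _ fun i' _ =>
    abs_rowCorr_sq_le (μ := μ) hb (r i) (r i')).trans ?_
  simp

theorem integrable_colFluct_sq (hh : Measurable (Function.uncurry h))
    (hb : ∀ r t, ‖h r t‖ ≤ 2) :
    Integrable (fun p : (Fin N → α) × (Fin N → β) => colFluct μ h p.2 p.1 ^ 2)
      ((Measure.pi fun _ => μ).prod (Measure.pi fun _ => ν)) :=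
  integrable_of_bounded ((measurable_colFluct hh).pow_const 2)
    (B := (N * (N * (16 * N ^ 2)) + N * (N - 1) * (N * (N * 16))) ^ 2) fun p => by
      rw [norm_pow]
      gcongr
      exact abs_colFluct_le hb _ _

/-- Conditionally on `r` this is the variance of a U-statistic in `t`. Its projection is controlled
by `integral_sq_sum_pairKernel_le`, and its kernel is nonnegative and at most `16 N²`, so the second
moment is at most `16 N²` times the mean. The constant is `4 · 768 + 32 · 16 = 3584`. -/
theorem integral_colFluct_sq_le (hh : Measurable (Function.uncurry h))
    (hb : ∀ r t, ‖h r t‖ ≤ 2) (hε : 0 ≤ ε)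
    (hcol : ∀ t, ∫ t', ‖∫ r, h r t * (starRingEnd ℂ) (h r t') ∂ν‖ ^ 2 ∂μ ≤ ε)
    (hrow : ∀ r, ∫ r', ‖∫ t, h r t * (starRingEnd ℂ) (h r' t) ∂μ‖ ^ 2 ∂ν ≤ ε) :
    ∫ p : (Fin N → α) × (Fin N → β), colFluct μ h p.2 p.1 ^ 2
      ∂((Measure.pi fun _ => μ).prod (Measure.pi fun _ => ν)) ≤
      3584 * N ^ 3 * (N + N ^ 2 * ε) ^ 2 := by
  have hN0 : (0 : ℝ) ≤ N := Nat.cast_nonneg N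
  have hPm : Measurable fun q : (Fin N → β) × α =>
      (∑ i, ∑ i', pairKernel μ h q.2 (q.1 i) (q.1 i')) ^ 2 := by
    refine Measurable.pow_const (Finset.measurable_sum _ fun i _ =>
      Finset.measurable_sum _ fun i' _ => ?_) 2
    exact (measurable_pairKernel hh).comp (by fun_prop :
      Measurable fun q : (Fin N → β) × α => (q.2, q.1 i, q.1 i'))
  have hPi : Integrable (fun q : (Fin N → β) × α =>
      (∑ i, ∑ i', pairKernel μ h q.2 (q.1 i) (q.1 i')) ^ 2)
      ((Measure.pi fun _ => ν).prod μ) :=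
    integrable_of_bounded hPm (B := (N * (N * 16)) ^ 2) fun q => by
      rw [norm_pow]
      gcongr
      refine (norm_sum_le_of_le _ fun i _ => norm_sum_le_of_le _ fun i' _ =>
        abs_pairKernel_le' (μ := μ) hb q.2 (q.1 i) (q.1 i')).trans ?_
      simp
  have hCm : Measurable fun r : Fin N → β => ∑ i, ∑ i', rowCorrSq μ h (r i) (r i') :=
    Finset.measurable_sum _ fun i _ => Finset.measurable_sum _ fun i' _ =>
      measurable_rowCorrSq_comp hh (by fun_prop) (by fun_prop)
  have hCi : Integrable (fun r : Fin N → β => ∑ i, ∑ i', rowCorrSq μ h (r i) (r i'))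
      (Measure.pi fun _ => ν) :=
    integrable_of_bounded hCm (B := N * (N * 16)) fun r => by
      refine (norm_sum_le_of_le _ fun i _ => norm_sum_le_of_le _ fun i' _ =>
        abs_rowCorr_sq_le (μ := μ) hb (r i) (r i')).trans ?_
      simp
  have hr : ∀ r : Fin N → β, ∫ t, colFluct μ h r t ^ 2 ∂(Measure.pi fun _ : Fin N => μ) ≤
      4 * N ^ 3 * (∫ t, (∑ i, ∑ i', pairKernel μ h t (r i) (r i')) ^ 2 ∂μ) +
      32 * N ^ 4 * ∑ i, ∑ i', rowCorrSq μ h (r i) (r i') := by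
    intro r
    have hK : Measurable (Function.uncurry (colCorrSq h r)) :=
      (measurable_colCorrSq hh).comp (by fun_prop : Measurable fun p : α × α => (r, p.1, p.2))
    have hKb := abs_colCorrSq_le hb r
    have hvar := integral_sq_offDiag_sub_le (μ := μ) (N := N) (K := colCorrSq h r) hK (colCorrSq_swap r) hKb
    rw [integral_integral_colCorrSq hh hb] at hvar
    simp_rw [integral_colCorrSq hh hb] at hvar
    refine hvar.trans (add_le_add le_rfl ?_)
    have hKi : ∀ t, Integrable (colCorrSq h r t) μ := fun t =>
      integrable_of_bounded hK.of_uncurry_left (hKb t)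
    have hKi' : Integrable (fun t => ∫ t', colCorrSq h r t t' ∂μ) μ :=
      integrable_of_bounded (hK.stronglyMeasurable.integral_prod_right').measurable
        (B := 16 * N ^ 2) fun t => by
          refine (norm_integral_le_of_norm_le_const (ae_of_all _ (hKb t))).trans ?_
          simp
    have h1 : ∀ t, ∫ t', colCorrSq h r t t' ^ 2 ∂μ ≤
        16 * N ^ 2 * ∫ t', colCorrSq h r t t' ∂μ := fun t => by
      rw [← integral_const_mul]
      refine integral_mono_of_nonneg (ae_of_all _ fun _ => sq_nonneg _)
        ((hKi t).const_mul _) (ae_of_all _ fun t' => ?_)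
      simp only
      rw [pow_two]
      exact mul_le_mul_of_nonneg_right (colCorrSq_le hb r t t') (colCorrSq_nonneg _ _ _ _)
    have h2 : ∫ t, ∫ t', colCorrSq h r t t' ^ 2 ∂μ ∂μ ≤
        16 * N ^ 2 * ∑ i, ∑ i', rowCorrSq μ h (r i) (r i') := by
      rw [← integral_integral_colCorrSq hh hb, ← integral_const_mul]
      exact integral_mono_of_nonneg (ae_of_all _ fun _ => integral_nonneg fun _ => sq_nonneg _)
        (hKi'.const_mul _) (ae_of_all _ h1)
    calc _ ≤ 2 * (N : ℝ) ^ 2 *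
          (16 * N ^ 2 * ∑ i, ∑ i', rowCorrSq μ h (r i) (r i')) := by gcongr
      _ = _ := by ring
  rw [integral_prod_symm _ (integrable_colFluct_sq hh hb)]
  have hI1 := hPi.integral_prod_left.const_mul (4 * (N : ℝ) ^ 3)
  have hI2 := hCi.const_mul (32 * (N : ℝ) ^ 4)
  refine (integral_mono_of_nonneg (ae_of_all _ fun _ => integral_nonneg fun _ => sq_nonneg _)
    (hI1.add hI2) (ae_of_all _ hr)).trans ((integral_add hI1 hI2).trans_le ?_)
  rw [integral_const_mul, integral_const_mul]
  have hswap : ∫ r : Fin N → β, ∫ t, (∑ i, ∑ i', pairKernel μ h t (r i) (r i')) ^ 2 ∂μ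
      ∂(Measure.pi fun _ => ν) ≤ 768 * (N + N ^ 2 * ε) ^ 2 := by
    rw [integral_integral_swap (f := fun (r : Fin N → β) t =>
      (∑ i, ∑ i', pairKernel μ h t (r i) (r i')) ^ 2) hPi]
    refine (integral_mono_of_nonneg (ae_of_all _ fun _ => integral_nonneg fun _ => sq_nonneg _)
      (integrable_const _)
      (ae_of_all _ (integral_sq_sum_pairKernel_le hh hb hε hcol hrow))).trans ?_
    simp
  have hC := integral_sum_rowCorr_le (N := N) hh hb hε hrow
  have hAN : (N : ℝ) ≤ N + N ^ 2 * ε := by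
    have : 0 ≤ (N : ℝ) ^ 2 * ε := by positivity
    linarith
  have hC' : ∫ r : Fin N → β, ∑ i, ∑ i', rowCorrSq μ h (r i) (r i') ∂(Measure.pi fun _ => ν) ≤
      16 * (N + N ^ 2 * ε) := by
    refine hC.trans ?_
    have : 0 ≤ (N : ℝ) ^ 2 * ε := by positivity
    linarith
  set A := (N : ℝ) + N ^ 2 * ε
  calc _ ≤ 4 * (N : ℝ) ^ 3 * (768 * A ^ 2) + 32 * N ^ 4 * (16 * A) := by gcongr
    _ = 3072 * N ^ 3 * A ^ 2 + 512 * N ^ 3 * (N * A) := by ring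
    _ ≤ 3072 * N ^ 3 * A ^ 2 + 512 * N ^ 3 * (A * A) := by gcongr
    _ = _ := by ring

theorem real_le_div_of_integral_le {γ : Type*} [MeasurableSpace γ] {σ : Measure γ}
    [IsProbabilityMeasure σ] {f : γ → ℝ} (hf : ∀ x, 0 ≤ f x) (hi : Integrable f σ) {a b : ℝ}
    (ha : 0 < a) (h : ∫ x, f x ∂σ ≤ b * a) : σ.real {x | a ≤ f x} ≤ b := by
  have := mul_meas_ge_le_integral_of_nonneg (ae_of_all _ hf) hi a
  nlinarith

/-- With high probability, the fourth Schatten moment of a random kernel matrix is controlled by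
the operator bounds of the kernel. -/
theorem real_sum_colCorrSq_gt_le (hN : 0 < N) (hh : Measurable (Function.uncurry h))
    (hb : ∀ r t, ‖h r t‖ ≤ 2) (hε : 0 ≤ ε)
    (hcol : ∀ t, ∫ t', ‖∫ r, h r t * (starRingEnd ℂ) (h r t') ∂ν‖ ^ 2 ∂μ ≤ ε)
    (hrow : ∀ r, ∫ r', ‖∫ t, h r t * (starRingEnd ℂ) (h r' t) ∂μ‖ ^ 2 ∂ν ≤ ε) :
    ((Measure.pi fun _ : Fin N => μ).prod (Measure.pi fun _ : Fin N => ν)).real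
      {p | 34 * N ^ 2 * (N + N ^ 2 * ε) < ∑ k, ∑ k', colCorrSq h p.2 (p.1 k) (p.1 k')} ≤
      3604 / N := by
  have hNpos : (0 : ℝ) < N := by exact_mod_cast hN
  have hQm := measurable_rowCorr_sq (μ := μ) hh
  have hQb := abs_rowCorr_sq_le (μ := μ) hb
  have hq := integral_integral_rowCorr_le (h := h) hrow
  have hvar := integral_sq_offDiag_sub_le (μ := ν) (N := N) (K := rowCorrSq μ h) hQm
    (fun r r' => by rw [rowCorrSq, rowCorrSq, rowCorr_swap r r', RCLike.norm_conj]) hQb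
  set q := ∫ r, ∫ r', rowCorrSq μ h r r' ∂ν ∂ν with hqdef
  set A := (N : ℝ) + N ^ 2 * ε with hA
  have hNε : 0 ≤ (N : ℝ) ^ 2 * ε := by positivity
  have hAN : (N : ℝ) ≤ A := by linarith
  have hA0 : 0 < A := by linarith
  set S2 : (Fin N → β) → ℝ := fun r =>
    (∑ i, ∑ i', if i = i' then 0 else rowCorrSq μ h (r i) (r i')) - N * (N - 1) * q with hS2
  have hS2m : Measurable S2 := (measurable_sum_offDiag hQm).sub_const _
  have hS2i : Integrable (fun p : (Fin N → α) × (Fin N → β) => S2 p.2 ^ 2)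
      ((Measure.pi fun _ => μ).prod (Measure.pi fun _ => ν)) :=
    integrable_of_bounded ((hS2m.comp measurable_snd).pow_const 2)
      (B := (N * (N * 16) + |N * (N - 1) * q|) ^ 2) fun p => by
        rw [norm_pow]
        gcongr
        exact (abs_sub _ _).trans (by gcongr; exact abs_sum_offDiag_le (K := rowCorrSq μ h) hQb p.2)
  have hk1 : ∀ r, (∫ r', rowCorrSq μ h r r' ∂ν) ^ 2 ≤ ε ^ 2 := fun r =>
    pow_le_pow_left₀ (integral_nonneg fun _ => rowCorrSq_nonneg _ _ _ _)
      (integral_rowCorrSq_le hrow r) 2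
  have hE1 : ∫ r, (∫ r', rowCorrSq μ h r r' ∂ν) ^ 2 ∂ν ≤ ε ^ 2 :=
    (integral_mono_of_nonneg (ae_of_all _ fun r => sq_nonneg _)
      (integrable_const (ε ^ 2)) (ae_of_all _ hk1)).trans (by simp)
  have hk2 : ∀ r, ∫ r', (rowCorrSq μ h r r') ^ 2 ∂ν ≤ 16 * ε := fun r => by
    refine (integral_mono_of_nonneg (ae_of_all _ fun r' => sq_nonneg _)
      ((integrable_of_bounded (hQm.of_uncurry_left (x := r)) (hQb r)).const_mul 16)
      (ae_of_all _ fun r' => ?_)).trans ?_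
    · simp only
      have := (le_abs_self _).trans (hQb r r')
      nlinarith [rowCorrSq_nonneg μ h r r']
    · rw [integral_const_mul]
      have := hrow r
      simp only [rowCorrSq, rowCorr]
      linarith
  have hE2 : ∫ r, ∫ r', (rowCorrSq μ h r r') ^ 2 ∂ν ∂ν ≤ 16 * ε :=
    (integral_mono_of_nonneg (ae_of_all _ fun r => integral_nonneg fun r' => sq_nonneg _)
      (integrable_const (16 * ε)) (ae_of_all _ hk2)).trans (by simp)
  -- Chebyshev for the columns at level `N² A`: the ratio `3584 N³ A² / (N² A)²` is `3584 / N`.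
  have hP1 := real_le_div_of_integral_le (fun _ => sq_nonneg _)
    (integrable_colFluct_sq (N := N) (μ := μ) (ν := ν) hh hb) (a := (N ^ 2 * A) ^ 2)
    (b := 3584 / N) (by positivity) (by
      refine (integral_colFluct_sq_le hh hb hε hcol hrow).trans_eq ?_
      rw [← hA]
      field_simp)
  -- Chebyshev for the rows at level `A`: the variance is at most `4 N³ ε² + 32 N² ε`, hence at most
  -- `20 A² / N`.
  have hP2 := real_le_div_of_integral_le (fun _ => sq_nonneg _) hS2i (a := A ^ 2)
    (b := 20 / N) (by positivity) (by
      have e := integral_fun_snd (μ := Measure.pi fun _ : Fin N => μ)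
        (ν := Measure.pi fun _ : Fin N => ν) (fun r => S2 r ^ 2)
      rw [e, probReal_univ, one_smul]
      refine hvar.trans ?_
      calc _ ≤ 4 * (N : ℝ) ^ 3 * ε ^ 2 + 2 * N ^ 2 * (16 * ε) := by gcongr
        _ ≤ 20 / N * (N ^ 2 + 2 * N ^ 3 * ε + N ^ 4 * ε ^ 2) := by
            have : 20 / (N : ℝ) * (N ^ 2 + 2 * N ^ 3 * ε + N ^ 4 * ε ^ 2) =
              20 * N + 40 * N ^ 2 * ε + 20 * N ^ 3 * ε ^ 2 := by field_simp; ring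
            rw [this]
            have h1 : 0 ≤ (N : ℝ) ^ 3 * ε ^ 2 := by positivity
            linarith
        _ = _ := by rw [hA]; ring)
  -- Off both events the row sum is at most `16 N + N² ε + A ≤ 17 A`. The column sum is then at most
  -- `16 N³` from the diagonal, plus `N² A` and `17 N² A`, which is at most `34 N² A`.
  have hsub : {p : (Fin N → α) × (Fin N → β) |
      34 * N ^ 2 * A < ∑ k, ∑ k', colCorrSq h p.2 (p.1 k) (p.1 k')} ⊆
      {p | (N ^ 2 * A) ^ 2 ≤ colFluct μ h p.2 p.1 ^ 2} ∪ {p | A ^ 2 ≤ S2 p.2 ^ 2} := by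
    intro p hp
    by_contra hcon
    simp only [Set.mem_union, Set.mem_ofPred_eq, not_or, not_le] at hcon hp
    have h1 := (abs_lt_of_sq_lt_sq hcon.1 (by positivity))
    have h2 := (abs_lt_of_sq_lt_sq hcon.2 (by positivity))
    have h1' := (abs_lt.1 h1).2
    have h2' := (abs_lt.1 h2).2
    have d1 := (abs_le.1 (abs_sum_diag_le (K := colCorrSq h p.2) (abs_colCorrSq_le hb p.2) p.1)).2
    have d2 := (abs_le.1 (abs_sum_diag_le (K := rowCorrSq μ h) hQb p.2)).2
    simp only [colFluct, hS2] at h1' h2'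
    set C := ∑ i, ∑ i', rowCorrSq μ h (p.2 i) (p.2 i')
    have hC0 : 0 ≤ C := Finset.sum_nonneg fun i _ => Finset.sum_nonneg fun i' _ => rowCorrSq_nonneg _ _ _ _
    have hq0 : 0 ≤ q := integral_nonneg fun _ => integral_nonneg fun _ => rowCorrSq_nonneg _ _ _ _
    have hNN : (N : ℝ) * (N - 1) ≤ N ^ 2 := by nlinarith
    have h3 : N * (N - 1) * q ≤ N ^ 2 * ε := by gcongr
    have h4 : C ≤ 17 * A := by linarith
    have h5 : N * (N - 1) * C ≤ N ^ 2 * (17 * A) := by gcongr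
    have h6 : (N : ℝ) ^ 2 * N ≤ N ^ 2 * A := by gcongr
    nlinarith
  calc _ ≤ _ := measureReal_mono hsub
    _ ≤ _ := measureReal_union_le _ _
    _ ≤ 3584 / N + 20 / N := add_le_add hP1 hP2
    _ = 3604 / N := by ring

end RandomMatrixMoments


/-! ### Oscillatory integrals of spherical waves along a segment -/

section Oscillation

/-- The expression is the numerator of the derivative of a path difference. If `p q ≤ 0` the two
terms reinforce each other. Otherwise multiply by the conjugate: the product is `c² (p - q) (p +
q)`, and the conjugate is at most `√2 c |p + q|` because `|p|, |q| ≤ c`. -/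
theorem sq_wronskian_ge {c p q : ℝ} (hc : 0 < c) (hp : |p| ≤ c) (hq : |q| ≤ c) :
    (c * |p - q| / 2) ^ 2 ≤ (p * √(c ^ 2 + q ^ 2) - q * √(c ^ 2 + p ^ 2)) ^ 2 := by
  have hp2 : p ^ 2 ≤ c ^ 2 := sq_le_sq' (by linarith [abs_le.1 hp]) (abs_le.1 hp).2
  have hq2 : q ^ 2 ≤ c ^ 2 := sq_le_sq' (by linarith [abs_le.1 hq]) (abs_le.1 hq).2
  have e1 : √(c ^ 2 + q ^ 2) ^ 2 = c ^ 2 + q ^ 2 := Real.sq_sqrt (by positivity)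
  have e2 : √(c ^ 2 + p ^ 2) ^ 2 = c ^ 2 + p ^ 2 := Real.sq_sqrt (by positivity)
  have hx : c ≤ √(c ^ 2 + q ^ 2) := Real.le_sqrt_of_sq_le (by nlinarith [sq_nonneg q])
  have hy : c ≤ √(c ^ 2 + p ^ 2) := Real.le_sqrt_of_sq_le (by nlinarith [sq_nonneg p])
  set x := √(c ^ 2 + q ^ 2)
  set y := √(c ^ 2 + p ^ 2)
  rw [div_pow, mul_pow, sq_abs]
  have hxy : c ^ 2 ≤ x * y := by nlinarith
  have hxy2 : x * y ≤ 2 * c ^ 2 := by nlinarith [sq_nonneg (x - y)]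
  have hexp : (p * x - q * y) ^ 2 = c ^ 2 * (p ^ 2 + q ^ 2) + 2 * p ^ 2 * q ^ 2
      - 2 * (p * q) * (x * y) := by
    linear_combination p ^ 2 * e1 + q ^ 2 * e2
  rcases le_total (p * q) 0 with hpq | hpq
  · rw [hexp]
    nlinarith [mul_nonneg (neg_nonneg.2 hpq) (sub_nonneg.2 hxy), sq_nonneg (p * q),
      mul_nonneg (sq_nonneg c) (sq_nonneg (p - q))]
  · have hexp' : (p * x + q * y) ^ 2 = c ^ 2 * (p ^ 2 + q ^ 2) + 2 * p ^ 2 * q ^ 2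
        + 2 * (p * q) * (x * y) := by
      linear_combination p ^ 2 * e1 + q ^ 2 * e2
    have hle : (p * x + q * y) ^ 2 ≤ 2 * c ^ 2 * (p + q) ^ 2 := by
      rw [hexp']
      have hpq2 : p * q ≤ c ^ 2 := by nlinarith [sq_nonneg (p - q)]
      have : p ^ 2 * q ^ 2 ≤ c ^ 2 * (p * q) := by
        nlinarith [mul_nonneg hpq (sub_nonneg.2 hpq2)]
      nlinarith [mul_nonneg hpq (sub_nonneg.2 hxy2), sq_nonneg (p - q),
        mul_nonneg (sq_nonneg c) (sq_nonneg (p - q)), mul_nonneg (sq_nonneg c) hpq]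
    have hprod : (p * x - q * y) ^ 2 * (p * x + q * y) ^ 2 =
        (c ^ 2 * (p - q) * (p + q)) ^ 2 := by
      have : (p * x - q * y) * (p * x + q * y) = c ^ 2 * (p - q) * (p + q) := by
        linear_combination p ^ 2 * e1 - q ^ 2 * e2
      rw [← mul_pow, this]
    rcases eq_or_ne (p + q) 0 with h0 | h0
    · have : p = 0 := by nlinarith [sq_nonneg p, sq_nonneg q]
      have : q = 0 := by linarith
      subst_vars
      simp
    · have h1 : 0 < (p + q) ^ 2 := by positivity
      have h2 : (c ^ 2 * (p - q) * (p + q)) ^ 2 ≤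
          (p * x - q * y) ^ 2 * (2 * c ^ 2 * (p + q) ^ 2) := by
        rw [← hprod]; gcongr
      have h3 : (c ^ 2 * (p + q) ^ 2) * (c ^ 2 * (p - q) ^ 2) ≤
          (c ^ 2 * (p + q) ^ 2) * (2 * (p * x - q * y) ^ 2) := by nlinarith
      have h4 := le_of_mul_le_mul_left h3 (by positivity)
      nlinarith [mul_nonneg (sq_nonneg c) (sq_nonneg (p - q))]

theorem abs_wronskian_ge {c p q : ℝ} (hc : 0 < c) (hp : |p| ≤ c) (hq : |q| ≤ c) :
    c * |p - q| / 2 ≤ |p * √(c ^ 2 + q ^ 2) - q * √(c ^ 2 + p ^ 2)| := by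
  apply le_of_sq_le_sq _ (abs_nonneg _)
  rw [sq_abs]
  exact sq_wronskian_ge hc hp hq

/-- With `x = √(c² + q²)` and `y = √(c² + p²)` the difference factors as `(x - y) (1 - p q / (x
y))`, where `|x - y| ≤ |p - q|` and `|p q| ≤ x y`. -/
theorem abs_deriv_wronskian_le {c : ℝ} (hc : 0 < c) (p q : ℝ) :
    |(√(c ^ 2 + q ^ 2) + p * (q / √(c ^ 2 + q ^ 2))) -
      (√(c ^ 2 + p ^ 2) + q * (p / √(c ^ 2 + p ^ 2)))| ≤ 2 * |p - q| := by
  have e1 : √(c ^ 2 + q ^ 2) ^ 2 = c ^ 2 + q ^ 2 := Real.sq_sqrt (by positivity)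
  have e2 : √(c ^ 2 + p ^ 2) ^ 2 = c ^ 2 + p ^ 2 := Real.sq_sqrt (by positivity)
  have hx0 : 0 < √(c ^ 2 + q ^ 2) := Real.sqrt_pos.2 (by positivity)
  have hy0 : 0 < √(c ^ 2 + p ^ 2) := Real.sqrt_pos.2 (by positivity)
  have hx : |q| ≤ √(c ^ 2 + q ^ 2) := Real.abs_le_sqrt (by nlinarith [sq_nonneg c])
  have hy : |p| ≤ √(c ^ 2 + p ^ 2) := Real.abs_le_sqrt (by nlinarith [sq_nonneg c])
  set x := √(c ^ 2 + q ^ 2)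
  set y := √(c ^ 2 + p ^ 2)
  have h1 : |x - y| ≤ |p - q| := by
    have h2 : (x - y) * (x + y) = (q - p) * (q + p) := by linear_combination e1 - e2
    have h3 : |x - y| * (x + y) ≤ |p - q| * (x + y) := by
      rw [← abs_of_pos (add_pos hx0 hy0), ← abs_mul, h2, abs_mul, abs_of_pos (add_pos hx0 hy0),
        abs_sub_comm q p]
      gcongr
      exact (abs_add_le _ _).trans (by linarith)
    exact le_of_mul_le_mul_right h3 (add_pos hx0 hy0)
  have h4 : |p * q / (x * y)| ≤ 1 := by
    rw [abs_div, abs_mul, abs_of_pos (mul_pos hx0 hy0), div_le_one (mul_pos hx0 hy0), mul_comm]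
    exact mul_le_mul hx hy (abs_nonneg _) hx0.le
  have h5 : (x + p * (q / x)) - (y + q * (p / y)) = (x - y) * (1 - p * q / (x * y)) := by
    field_simp
    ring
  rw [h5, abs_mul, mul_comm 2]
  gcongr
  exact (abs_sub _ _).trans (by rw [abs_one]; linarith)

theorem hasDerivAt_sqrt_sq_add {c : ℝ} (hc : 0 < c) (v b : ℝ) :
    HasDerivAt (fun b => √(c ^ 2 + (b - v) ^ 2)) ((b - v) / √(c ^ 2 + (b - v) ^ 2)) b := by
  have h : HasDerivAt (fun b => c ^ 2 + (b - v) ^ 2) (2 * (b - v)) b := by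
    have := (((hasDerivAt_id b).sub_const v).pow 2).const_add (c ^ 2)
    simpa using this
  convert! h.sqrt (by positivity) using 1
  field_simp

/-- Decay of the oscillatory integral of a product of two spherical waves along a segment. -/
theorem norm_integral_wave_le {c κ D v v' : ℝ} (hc : 0 < c) (hκ : 0 < κ) (hD : 0 < D)
    (hDc : D ≤ c) (hv : v ∈ Set.Icc 0 D) (hv' : v' ∈ Set.Icc 0 D) (hne : v ≠ v') :
    ‖∫ b in (0 : ℝ)..D, ((1 / (√(c ^ 2 + (b - v) ^ 2) * √(c ^ 2 + (b - v') ^ 2)) : ℝ) : ℂ) *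
      Complex.exp (-Complex.I * ((κ * (√(c ^ 2 + (b - v) ^ 2) - √(c ^ 2 + (b - v') ^ 2)) : ℝ) : ℂ))‖
      ≤ 12 / (κ * c * |v - v'|) := by
  set d : ℝ → ℝ := fun b => √(c ^ 2 + (b - v) ^ 2) with hd
  set d' : ℝ → ℝ := fun b => √(c ^ 2 + (b - v') ^ 2) with hd'
  have hdpos : ∀ b, 0 < d b := fun b => Real.sqrt_pos.2 (by positivity)
  have hdpos' : ∀ b, 0 < d' b := fun b => Real.sqrt_pos.2 (by positivity)
  have hdd : ∀ b, HasDerivAt d ((b - v) / d b) b := hasDerivAt_sqrt_sq_add hc v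
  have hdd' : ∀ b, HasDerivAt d' ((b - v') / d' b) b := hasDerivAt_sqrt_sq_add hc v'
  have hdc : Continuous d := by fun_prop
  have hdc' : Continuous d' := by fun_prop
  set W : ℝ → ℝ := fun b => (b - v) * d' b - (b - v') * d b with hW
  set W' : ℝ → ℝ := fun b => (d' b + (b - v) * ((b - v') / d' b)) -
    (d b + (b - v') * ((b - v) / d b)) with hW'
  have hWd : ∀ b, HasDerivAt W (W' b) b := fun b => by
    have h1 := ((hasDerivAt_id b).sub_const v).mul (hdd' b)
    have h2 := ((hasDerivAt_id b).sub_const v').mul (hdd b)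
    convert! h1.sub h2 using 1
    simp [hW', hd, hd']
  have hΔ : 0 < |v - v'| := abs_pos.2 (sub_ne_zero.2 hne)
  have hWlow : ∀ b ∈ Set.Icc 0 D, c * |v - v'| / 2 ≤ |W b| := fun b hb => by
    have hp : |b - v| ≤ c := abs_le.2 ⟨by linarith [hb.1, hv.2], by linarith [hb.2, hv.1]⟩
    have hq : |b - v'| ≤ c := abs_le.2 ⟨by linarith [hb.1, hv'.2], by linarith [hb.2, hv'.1]⟩
    have := abs_wronskian_ge hc hp hq
    rwa [show b - v - (b - v') = -(v - v') by ring, abs_neg] at this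
  have hWup : ∀ b, |W' b| ≤ 2 * |v - v'| := fun b => by
    have := abs_deriv_wronskian_le hc (b - v) (b - v')
    rwa [show b - v - (b - v') = -(v - v') by ring, abs_neg] at this
  have hW0 : ∀ b ∈ Set.Icc 0 D, W b ≠ 0 := fun b hb h0 => by
    have := hWlow b hb
    rw [h0, abs_zero] at this
    have : 0 < c * |v - v'| / 2 := by positivity
    linarith
  set E : ℝ → ℂ := fun b => Complex.exp (-Complex.I * ((κ * (d b - d' b) : ℝ) : ℂ)) with hE
  have hEn : ∀ b, ‖E b‖ = 1 := fun b => by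
    rw [hE, Complex.norm_exp]; simp
  have hEc : Continuous E := by fun_prop
  set E' : ℝ → ℂ := fun b => E b * (-Complex.I * ((κ * ((b - v) / d b - (b - v') / d' b) : ℝ) : ℂ))
    with hE'
  have hEd : ∀ b, HasDerivAt E (E' b) b := fun b => by
    have h1 : HasDerivAt (fun b => κ * (d b - d' b)) (κ * ((b - v) / d b - (b - v') / d' b)) b :=
      ((hdd b).sub (hdd' b)).const_mul κ
    exact (h1.ofReal_comp.const_mul (-Complex.I)).cexp
  set u : ℝ → ℂ := fun b => (((W b)⁻¹ : ℝ) : ℂ) with hu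
  set u' : ℝ → ℂ := fun b => ((-W' b / W b ^ 2 : ℝ) : ℂ) with hu'
  have hIcc : Set.uIcc 0 D = Set.Icc 0 D := Set.uIcc_of_le hD.le
  have hud : ∀ b ∈ Set.uIcc 0 D, HasDerivAt u (u' b) b := fun b hb => by
    rw [hIcc] at hb
    exact ((hWd b).inv (hW0 b hb)).ofReal_comp
  have hWc : Continuous W := by fun_prop
  have hWc' : Continuous W' := by
    have := fun b => (hdpos b).ne'
    have := fun b => (hdpos' b).ne'
    fun_prop (disch := assumption)
  have huc' : IntervalIntegrable u' volume 0 D := by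
    apply ContinuousOn.intervalIntegrable
    rw [hIcc]
    refine Complex.continuous_ofReal.comp_continuousOn ?_
    exact hWc'.neg.continuousOn.div (hWc.pow 2).continuousOn fun b hb => pow_ne_zero 2 (hW0 b hb)
  have hEi : IntervalIntegrable E' volume 0 D := by
    apply Continuous.intervalIntegrable
    have := fun b => (hdpos b).ne'
    have := fun b => (hdpos' b).ne'
    refine hEc.mul (continuous_const.mul (Complex.continuous_ofReal.comp ?_))
    fun_prop (disch := assumption)
  have hibp := intervalIntegral.integral_mul_deriv_eq_deriv_mul hud (fun b _ => hEd b) huc' hEi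
  -- The derivative of `d - d'` is `W / (d d')`, so the amplitude `1 / (d d')` is the phase
  -- derivative over `κ W`. Integration by parts therefore only needs `|W|` bounded below and `|W'|`
  -- bounded above.
  have hmain : ∫ b in (0 : ℝ)..D, ((1 / (d b * d' b) : ℝ) : ℂ) * E b =
      (Complex.I / κ) * ∫ b in (0 : ℝ)..D, u b * E' b := by
    rw [← intervalIntegral.integral_const_mul]
    refine intervalIntegral.integral_congr fun b hb => ?_
    rw [hIcc] at hb
    have h1 : (b - v) / d b - (b - v') / d' b = W b * (1 / (d b * d' b)) := by
      have := (hdpos b).ne'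
      have := (hdpos' b).ne'
      simp only [hW]
      field_simp
    have hκ' : (κ : ℂ) ≠ 0 := by exact_mod_cast hκ.ne'
    have hWb : ((W b : ℝ) : ℂ) ≠ 0 := by exact_mod_cast hW0 b hb
    simp only [hu, hE', h1]
    generalize 1 / (d b * d' b) = z
    push_cast
    field_simp
    rw [Complex.I_sq]
    ring
  rw [hmain, hibp, norm_mul, norm_div, Complex.norm_I, Complex.norm_real, Real.norm_eq_abs,
    abs_of_pos hκ]
  have hun : ∀ b ∈ Set.Icc 0 D, ‖u b‖ ≤ 2 / (c * |v - v'|) := fun b hb => by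
    rw [hu, Complex.norm_real, norm_inv, Real.norm_eq_abs]
    calc |W b|⁻¹ ≤ (c * |v - v'| / 2)⁻¹ := by
          gcongr
          exact hWlow b hb
      _ = _ := by rw [inv_div]
  have hun' : ∀ b ∈ Set.Icc 0 D, ‖u' b‖ ≤ 8 / (c ^ 2 * |v - v'|) := fun b hb => by
    rw [hu', Complex.norm_real, norm_div, norm_neg, norm_pow, Real.norm_eq_abs, Real.norm_eq_abs]
    calc |W' b| / |W b| ^ 2 ≤ (2 * |v - v'|) / (c * |v - v'| / 2) ^ 2 := by
          gcongr
          · exact hWup b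
          · exact hWlow b hb
      _ = _ := by field_simp; norm_num
  have h3 : ‖∫ b in (0 : ℝ)..D, u' b * E b‖ ≤ 8 / (c ^ 2 * |v - v'|) * |D - 0| := by
    refine intervalIntegral.norm_integral_le_of_norm_le_const fun b hb => ?_
    rw [norm_mul, hEn, mul_one]
    rw [Set.uIoc_of_le hD.le] at hb
    exact hun' b ⟨hb.1.le, hb.2⟩
  have h1 : ‖u D * E D‖ ≤ 2 / (c * |v - v'|) := by
    rw [norm_mul, hEn, mul_one]; exact hun D ⟨hD.le, le_rfl⟩
  have h2 : ‖u 0 * E 0‖ ≤ 2 / (c * |v - v'|) := by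
    rw [norm_mul, hEn, mul_one]; exact hun 0 ⟨le_rfl, hD.le⟩
  -- `D ≤ c` absorbs the length of the segment. The constant 12 is 2 + 2 from the endpoints plus 8
  -- from this integral.
  have h4 : 8 / (c ^ 2 * |v - v'|) * |D - 0| ≤ 8 / (c * |v - v'|) := by
    rw [sub_zero, abs_of_pos hD]
    calc 8 / (c ^ 2 * |v - v'|) * D ≤ 8 / (c ^ 2 * |v - v'|) * c := by gcongr
      _ = _ := by field_simp
  calc 1 / κ * ‖u D * E D - u 0 * E 0 - ∫ b in (0 : ℝ)..D, u' b * E b‖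
      ≤ 1 / κ * (2 / (c * |v - v'|) + 2 / (c * |v - v'|) + 8 / (c * |v - v'|)) := by
        gcongr
        refine (norm_sub_le _ _).trans (add_le_add ((norm_sub_le _ _).trans
          (add_le_add h1 h2)) (h3.trans h4))
    _ = _ := by field_simp; norm_num

end Oscillation


/-! ### The wave kernel between two parallel segments -/

/-- The uniform distribution on the interval `[a, a + D]`. -/
noncomputable def uniformIcc (a D : ℝ) : Measure ℝ := ProbabilityTheory.cond volume (Set.Icc a (a + D))

theorem isProbabilityMeasure_uniformIcc (a : ℝ) {D : ℝ} (hD : 0 < D) :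
    IsProbabilityMeasure (uniformIcc a D) :=
  ProbabilityTheory.cond_isProbabilityMeasure_of_finite (by simp [hD]) (by simp)

theorem ae_uniformIcc_mem (a D : ℝ) : ∀ᵐ x ∂(uniformIcc a D), x ∈ Set.Icc a (a + D) :=
  ProbabilityTheory.ae_cond_mem measurableSet_Icc

theorem integral_uniformIcc {E : Type*} [NormedAddCommGroup E] [NormedSpace ℝ E] {D : ℝ}
    (hD : 0 < D) (f : ℝ → E) :
    ∫ x, f x ∂(uniformIcc 0 D) = D⁻¹ • ∫ x in (0 : ℝ)..D, f x := by
  rw [uniformIcc, ProbabilityTheory.cond, integral_smul_measure, zero_add, Real.volume_Icc,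
    sub_zero, ENNReal.toReal_inv, ENNReal.toReal_ofReal hD.le, integral_Icc_eq_integral_Ioc,
    intervalIntegral.integral_of_le hD.le]

theorem intervalIntegral_inv_sub_left {v β : ℝ} (hβ : 0 < β) (hv : 0 ≤ v) :
    ∫ x in (0 : ℝ)..v, (|v - x| + β)⁻¹ = Real.log (1 + v / β) := by
  have h : ∀ x ∈ Set.uIcc 0 v, HasDerivAt (fun x => -Real.log (v - x + β)) ((|v - x| + β)⁻¹) x := by
    intro x hx
    rw [Set.uIcc_of_le hv] at hx
    have hpos : 0 < v - x + β := by linarith [hx.2]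
    rw [abs_of_nonneg (by linarith [hx.2])]
    have h1 : HasDerivAt (fun x => v - x + β) (-1) x :=
      ((hasDerivAt_id x).const_sub v).add_const β
    convert! (h1.log hpos.ne').neg using 1
    rw [neg_div, neg_neg, one_div]
  have hc : Continuous fun x => (|v - x| + β)⁻¹ := by
    have : ∀ x, |v - x| + β ≠ 0 := fun x => by positivity
    fun_prop (disch := assumption)
  rw [intervalIntegral.integral_eq_sub_of_hasDerivAt h (hc.intervalIntegrable _ _)]
  simp only [sub_self, zero_add, sub_zero]
  rw [neg_sub_neg, ← Real.log_div (by positivity) hβ.ne']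
  congr 1
  field_simp
  ring

theorem intervalIntegral_inv_sub_right {v D β : ℝ} (hβ : 0 < β) (hv : v ≤ D) :
    ∫ x in v..D, (|v - x| + β)⁻¹ = Real.log (1 + (D - v) / β) := by
  have h : ∀ x ∈ Set.uIcc v D, HasDerivAt (fun x => Real.log (x - v + β)) ((|v - x| + β)⁻¹) x := by
    intro x hx
    rw [Set.uIcc_of_le hv] at hx
    have hpos : 0 < x - v + β := by linarith [hx.1]
    rw [abs_sub_comm, abs_of_nonneg (by linarith [hx.1])]
    have h1 : HasDerivAt (fun x => x - v + β) 1 x :=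
      ((hasDerivAt_id x).sub_const v).add_const β
    convert! (h1.log hpos.ne') using 1
    rw [one_div]
  have hc : Continuous fun x => (|v - x| + β)⁻¹ := by
    have : ∀ x, |v - x| + β ≠ 0 := fun x => by positivity
    fun_prop (disch := assumption)
  have : 0 ≤ D - v := by linarith
  rw [intervalIntegral.integral_eq_sub_of_hasDerivAt h (hc.intervalIntegrable _ _), sub_self,
    zero_add, ← Real.log_div (by positivity) hβ.ne']
  congr 1
  field_simp
  ring

/-- Splitting at `x = v` yields two logarithms, the origin of the logarithm in `dof`. -/
theorem integral_inv_abs_sub_add_le {D v β : ℝ} (hD : 0 < D) (hβ : 0 < β)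
    (hv : v ∈ Set.Icc 0 D) :
    ∫ x, (|v - x| + β)⁻¹ ∂(uniformIcc 0 D) ≤ 2 / D * Real.log (1 + D / β) := by
  have hc : Continuous fun x => (|v - x| + β)⁻¹ := by
    have : ∀ x, |v - x| + β ≠ 0 := fun x => by positivity
    fun_prop (disch := assumption)
  rw [integral_uniformIcc hD, ← intervalIntegral.integral_add_adjacent_intervals
    (hc.intervalIntegrable 0 v) (hc.intervalIntegrable v D), intervalIntegral_inv_sub_left hβ hv.1,
    intervalIntegral_inv_sub_right hβ hv.2, smul_eq_mul]
  have h0 := hv.1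
  have h1 : 0 ≤ D - v := sub_nonneg.2 hv.2
  have e1 : Real.log (1 + v / β) ≤ Real.log (1 + D / β) := by
    apply Real.log_le_log (by positivity)
    gcongr
    exact hv.2
  have e2 : Real.log (1 + (D - v) / β) ≤ Real.log (1 + D / β) := by
    apply Real.log_le_log (by positivity)
    gcongr
    linarith
  calc D⁻¹ * (Real.log (1 + v / β) + Real.log (1 + (D - v) / β))
      ≤ D⁻¹ * (Real.log (1 + D / β) + Real.log (1 + D / β)) := by gcongr
    _ = _ := by ring

/-- The normalized spherical wave at horizontal offset `c` and vertical offset `y`, with its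
amplitude truncated at distance `L / 2`. -/
noncomputable def wave (L κ c y : ℝ) : ℂ :=
  ((L / max √(c ^ 2 + y ^ 2) (L / 2) : ℝ) : ℂ) *
    Complex.exp (-Complex.I * ((κ * √(c ^ 2 + y ^ 2) : ℝ) : ℂ))

theorem norm_wave_le {L : ℝ} (hL : 0 < L) (κ c y : ℝ) : ‖wave L κ c y‖ ≤ 2 := by
  have h1 : 0 < max √(c ^ 2 + y ^ 2) (L / 2) := lt_max_of_lt_right (by positivity)
  rw [wave, norm_mul, Complex.norm_exp, Complex.norm_real, Real.norm_eq_abs,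
    abs_of_nonneg (by positivity)]
  simp only [Complex.mul_re, Complex.neg_re, Complex.I_re, neg_zero, zero_mul, Complex.neg_im,
    Complex.I_im, Complex.ofReal_im, mul_zero, sub_zero, Real.exp_zero, mul_one]
  rw [div_le_iff₀ h1]
  linarith [le_max_right √(c ^ 2 + y ^ 2) (L / 2)]

theorem continuous_wave {L : ℝ} (hL : 0 < L) (κ : ℝ) :
    Continuous fun p : ℝ × ℝ => wave L κ p.1 p.2 := by
  have : ∀ p : ℝ × ℝ, max √(p.1 ^ 2 + p.2 ^ 2) (L / 2) ≠ 0 := fun p =>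
    (lt_max_of_lt_right (by positivity)).ne'
  unfold wave
  fun_prop (disch := assumption)

theorem wave_neg (L κ c y : ℝ) : wave L κ (-c) (-y) = wave L κ c y := by
  simp [wave]

theorem norm_wave_mul_conj_le {L : ℝ} (hL : 0 < L) (κ c y y' : ℝ) :
    ‖wave L κ c y * (starRingEnd ℂ) (wave L κ c y')‖ ≤ 4 := by
  rw [norm_mul, RCLike.norm_conj]
  nlinarith [norm_wave_le hL κ c y, norm_wave_le hL κ c y', norm_nonneg (wave L κ c y),
    norm_nonneg (wave L κ c y')]

/-- Decay of the correlation of two waves along a segment. -/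
theorem norm_integral_wave_corr_le {L κ c D β v v' : ℝ} (hL : 0 < L) (hκ : 0 < κ) (hD : 0 < D)
    (hβ : 0 < β) (hcL : L / 2 ≤ |c|) (hcD : D ≤ |c|) (hβL : 6 * L ≤ κ * β * D)
    (hv : v ∈ Set.Icc 0 D) (hv' : v' ∈ Set.Icc 0 D) :
    ‖∫ b, wave L κ c (b - v) * (starRingEnd ℂ) (wave L κ c (b - v')) ∂(uniformIcc 0 D)‖ ≤
      8 * β * (|v - v'| + β)⁻¹ := by
  have := isProbabilityMeasure_uniformIcc 0 hD
  have hpos : 0 < |v - v'| + β := by positivity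
  rw [← div_eq_mul_inv, le_div_iff₀ hpos]
  -- Within distance `β` the trivial bound 4 suffices, since the right-hand side is then at least 4;
  -- beyond it the oscillation is used.
  rcases le_total |v - v'| β with hle | hge
  · have : ‖∫ b, wave L κ c (b - v) * (starRingEnd ℂ) (wave L κ c (b - v')) ∂(uniformIcc 0 D)‖ ≤
        4 := by
      refine (norm_integral_le_of_norm_le_const (ae_of_all _ fun b =>
        norm_wave_mul_conj_le hL κ c _ _)).trans ?_
      simp
    nlinarith [norm_nonneg (∫ b, wave L κ c (b - v) * (starRingEnd ℂ) (wave L κ c (b - v'))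
      ∂(uniformIcc 0 D))]
  · have hΔ : 0 < |v - v'| := hβ.trans_le hge
    have hne : v ≠ v' := sub_ne_zero.1 (abs_pos.1 hΔ)
    have hc : 0 < |c| := hD.trans_le hcD
    have hmax : ∀ y, max √(|c| ^ 2 + y ^ 2) (L / 2) = √(|c| ^ 2 + y ^ 2) := fun y =>
      max_eq_left (hcL.trans (Real.le_sqrt_of_sq_le (by nlinarith [sq_nonneg y])))
    have hw := norm_integral_wave_le hc hκ hD hcD hv hv' hne
    have e : ∀ b, wave L κ c (b - v) * (starRingEnd ℂ) (wave L κ c (b - v')) =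
        ((L ^ 2 : ℝ) : ℂ) * (((1 / (√(|c| ^ 2 + (b - v) ^ 2) * √(|c| ^ 2 + (b - v') ^ 2)) : ℝ) : ℂ) *
        Complex.exp (-Complex.I *
          ((κ * (√(|c| ^ 2 + (b - v) ^ 2) - √(|c| ^ 2 + (b - v') ^ 2)) : ℝ) : ℂ))) := by
      intro b
      rw [wave, wave, ← sq_abs c, hmax, hmax, map_mul, Complex.conj_ofReal, ← Complex.exp_conj,
        mul_mul_mul_comm, ← Complex.exp_add, ← mul_assoc, ← Complex.ofReal_mul,
        ← Complex.ofReal_mul]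
      refine congrArg₂ (· * ·) (congrArg _ ?_) (congrArg _ ?_)
      · rw [div_mul_div_comm]
        ring
      · simp only [map_mul, map_neg, Complex.conj_I, Complex.conj_ofReal]
        push_cast
        ring
    simp_rw [e]
    rw [integral_const_mul, integral_uniformIcc hD, norm_mul, norm_smul, Complex.norm_real,
      Real.norm_eq_abs, Real.norm_eq_abs, abs_of_pos (pow_pos hL 2), abs_of_pos (inv_pos.2 hD)]
    -- `|v - v'| + β ≤ 2 |v - v'|` cancels the decay; then `L ≤ 2 |c|` and `6 L ≤ κ β D` give `8 β`.
    calc L ^ 2 * (D⁻¹ * _) * (|v - v'| + β) ≤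
        L ^ 2 * (D⁻¹ * (12 / (κ * |c| * |v - v'|))) * (2 * |v - v'|) := by
          gcongr
          linarith
      _ = 24 * L ^ 2 / (D * κ * |c|) := by field_simp; ring
      _ ≤ 8 * β := by
          rw [div_le_iff₀ (by positivity)]
          calc 24 * L ^ 2 = 4 * L * (6 * L) := by ring
            _ ≤ 8 * |c| * (6 * L) := by nlinarith
            _ ≤ 8 * |c| * (κ * β * D) := by gcongr
            _ = _ := by ring

/-- The operator bound for the wave kernel between two parallel segments. -/
theorem integral_norm_sq_integral_wave_le {L κ c D β : ℝ} (hL : 0 < L) (hκ : 0 < κ) (hD : 0 < D)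
    (hβ : 0 < β) (hcL : L / 2 ≤ |c|) (hcD : D ≤ |c|) (hβL : 6 * L ≤ κ * β * D)
    {g : ℝ → ℂ} (hg : Measurable g) (hgb : ∀ v, ‖g v‖ ≤ 2) :
    ∫ b, ‖∫ v, g v * wave L κ c (b - v) ∂(uniformIcc 0 D)‖ ^ 2 ∂(uniformIcc 0 D) ≤
      64 * (β / D) * Real.log (1 + D / β) := by
  have := isProbabilityMeasure_uniformIcc 0 hD
  have hwm : Measurable fun p : ℝ × ℝ => wave L κ c (p.2 - p.1) :=
    ((continuous_wave hL κ).comp (by fun_prop : Continuous fun p : ℝ × ℝ => (c, p.2 - p.1))).measurable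
  have hm : Measurable (Function.uncurry fun v b => g v * wave L κ c (b - v)) :=
    (hg.comp measurable_fst).mul hwm
  have hb : ∀ v b, ‖g v * wave L κ c (b - v)‖ ≤ 4 := fun v b => by
    rw [norm_mul]
    nlinarith [hgb v, norm_wave_le hL κ c (b - v), norm_nonneg (g v),
      norm_nonneg (wave L κ c (b - v))]
  rw [integral_norm_sq_integral _ _ hm hb]
  have hc : ∀ v, Continuous fun x => (|v - x| + β)⁻¹ := fun v => by
    have : ∀ x, |v - x| + β ≠ 0 := fun x => by positivity
    fun_prop (disch := assumption)
  have hci : ∀ v, Integrable (fun x => 32 * β * (|v - x| + β)⁻¹) (uniformIcc 0 D) := fun v =>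
    (integrable_of_bounded (hc v).measurable (B := β⁻¹) fun x => by
      rw [norm_inv, Real.norm_eq_abs, abs_of_pos (by positivity)]
      gcongr
      linarith [abs_nonneg (v - x)]).const_mul _
  have hF : ∀ v v', v ∈ Set.Icc (0 : ℝ) D → v' ∈ Set.Icc (0 : ℝ) D →
      (∫ b, g v * wave L κ c (b - v) * (starRingEnd ℂ) (g v' * wave L κ c (b - v'))
        ∂(uniformIcc 0 D)).re ≤ 32 * β * (|v - v'| + β)⁻¹ := by
    intro v v' hv hv'
    have e : ∀ b, g v * wave L κ c (b - v) * (starRingEnd ℂ) (g v' * wave L κ c (b - v')) =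
        (g v * (starRingEnd ℂ) (g v')) *
          (wave L κ c (b - v) * (starRingEnd ℂ) (wave L κ c (b - v'))) := fun b => by
      rw [map_mul]; ring
    simp_rw [e]
    rw [integral_const_mul]
    refine (Complex.re_le_norm _).trans ?_
    rw [norm_mul, norm_mul, RCLike.norm_conj]
    have hcor := norm_integral_wave_corr_le hL hκ hD hβ hcL hcD hβL hv hv'
    calc _ ≤ 2 * 2 * (8 * β * (|v - v'| + β)⁻¹) := by
          gcongr
          · exact hgb v
          · exact hgb v'
      _ = _ := by ring
  have hFi : ∀ v, Integrable (fun v' => (∫ b, g v * wave L κ c (b - v) *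
      (starRingEnd ℂ) (g v' * wave L κ c (b - v')) ∂(uniformIcc 0 D)).re) (uniformIcc 0 D) := by
    intro v
    have h1 : Measurable fun p : ℝ × ℝ => g v * wave L κ c (p.2 - v) *
      (starRingEnd ℂ) (g p.1 * wave L κ c (p.2 - p.1)) :=
      (hm.comp (by fun_prop : Measurable fun p : ℝ × ℝ => (v, p.2))).mul
        (Complex.continuous_conj.measurable.comp hm)
    have h2 : Measurable fun v' => ∫ b, g v * wave L κ c (b - v) *
      (starRingEnd ℂ) (g v' * wave L κ c (b - v')) ∂(uniformIcc 0 D) :=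
      (h1.stronglyMeasurable.integral_prod_right' (ν := uniformIcc 0 D)).measurable
    refine (integrable_of_bounded h2 (B := 16) fun v' => ?_).re
    refine (norm_integral_le_of_norm_le_const (C := 16) (ae_of_all _ fun b => ?_)).trans (by simp)
    rw [norm_mul, RCLike.norm_conj]
    nlinarith [hb v b, hb v' b, norm_nonneg (g v * wave L κ c (b - v)),
      norm_nonneg (g v' * wave L κ c (b - v'))]
  have hin : ∀ v ∈ Set.Icc (0 : ℝ) D, ∫ v', (∫ b, g v * wave L κ c (b - v) *
      (starRingEnd ℂ) (g v' * wave L κ c (b - v')) ∂(uniformIcc 0 D)).re ∂(uniformIcc 0 D) ≤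
      64 * (β / D) * Real.log (1 + D / β) := by
    intro v hv
    have hmem := ae_uniformIcc_mem 0 D
    rw [zero_add] at hmem
    refine (integral_mono_ae (hFi v) (hci v) (hmem.mono fun v' hv' => hF v v' hv hv')).trans ?_
    rw [integral_const_mul]
    calc _ ≤ 32 * β * (2 / D * Real.log (1 + D / β)) := by
          gcongr
          exact integral_inv_abs_sub_add_le hD hβ hv
      _ = _ := by ring
  have hmem := ae_uniformIcc_mem 0 D
  rw [zero_add] at hmem
  have hlog : 0 ≤ Real.log (1 + D / β) := Real.log_nonneg (by
    have : 0 ≤ D / β := by positivity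
    linarith)
  -- If the outer function is not integrable, its integral is 0 by convention and the bound is
  -- trivial, so its measurability is never needed.
  by_cases hint : Integrable (fun v => ∫ v', (∫ b, g v * wave L κ c (b - v) *
      (starRingEnd ℂ) (g v' * wave L κ c (b - v')) ∂(uniformIcc 0 D)).re ∂(uniformIcc 0 D))
      (uniformIcc 0 D)
  · refine (integral_mono_ae hint (integrable_const (64 * (β / D) * Real.log (1 + D / β)))
      (hmem.mono hin)).trans ?_
    simp
  · rw [integral_undef hint]
    positivity

attribute [irreducible] wave


/-! ### The wave kernel between two squares -/

/-- Cartesian coordinates on the plane. -/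
noncomputable def planeEquiv : ℝ × ℝ ≃ᵐ Plane :=
  (MeasurableEquiv.finTwoArrow (α := ℝ)).symm.trans (MeasurableEquiv.toLp 2 (Fin 2 → ℝ))

theorem measurePreserving_planeEquiv : MeasurePreserving planeEquiv :=
  ((volume_preserving_finTwoArrow ℝ).symm _).trans (PiLp.volume_preserving_toLp (Fin 2))

theorem uniformSquare_eq_map {D : ℝ} (hD : 0 < D) (a : ℝ) :
    uniformSquare a D = ((uniformIcc a D).prod (uniformIcc 0 D)).map planeEquiv := by
  have hpre : planeEquiv ⁻¹' (square a D) = Set.Icc a (a + D) ×ˢ Set.Icc 0 (0 + D) := by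
    ext p
    rw [Set.mem_prod, zero_add]
    rfl
  have hvol : volume (square a D) = ENNReal.ofReal D * ENNReal.ofReal D := by
    rw [← measurePreserving_planeEquiv.measure_preimage_equiv, hpre, Measure.volume_eq_prod,
      Measure.prod_prod, Real.volume_Icc, Real.volume_Icc]
    simp
  have hr := (measurePreserving_planeEquiv.restrict_preimage_emb planeEquiv.measurableEmbedding
    (square a D)).map_eq
  have hD0 : ENNReal.ofReal D ≠ 0 := by simpa using hD
  rw [uniformSquare, uniformIcc, uniformIcc, ProbabilityTheory.cond, ProbabilityTheory.cond,
    ProbabilityTheory.cond, hvol, ← hr, hpre, Measure.volume_eq_prod, ← Measure.prod_restrict,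
    Measure.prod_smul_left, Measure.prod_smul_right, smul_smul, Measure.map_smul, Real.volume_Icc,
    Real.volume_Icc, ENNReal.mul_inv (Or.inl hD0) (Or.inl ENNReal.ofReal_ne_top)]
  simp

theorem isProbabilityMeasure_uniformSquare {D : ℝ} (hD : 0 < D) (a : ℝ) :
    IsProbabilityMeasure (uniformSquare a D) := by
  have := isProbabilityMeasure_uniformIcc a hD
  have := isProbabilityMeasure_uniformIcc 0 hD
  rw [uniformSquare_eq_map hD]
  exact Measure.isProbabilityMeasure_map planeEquiv.measurable.aemeasurable

theorem integral_uniformSquare {E : Type*} [NormedAddCommGroup E] [NormedSpace ℝ E] {D : ℝ}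
    (hD : 0 < D) (a : ℝ) (f : Plane → E) :
    ∫ p, f p ∂(uniformSquare a D) =
      ∫ p, f (planeEquiv p) ∂((uniformIcc a D).prod (uniformIcc 0 D)) := by
  rw [uniformSquare_eq_map hD, integral_map_equiv]

theorem measurableSet_square (a D : ℝ) : MeasurableSet (square a D) := by
  have : square a D = (fun p : Plane => p 0) ⁻¹' Set.Icc a (a + D) ∩
      (fun p : Plane => p 1) ⁻¹' Set.Icc 0 D := rfl
  rw [this]
  have h0 : Measurable fun p : Plane => p 0 := by fun_prop
  have h1 : Measurable fun p : Plane => p 1 := by fun_prop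
  exact (h0 measurableSet_Icc).inter (h1 measurableSet_Icc)

theorem ae_uniformSquare_mem (a D : ℝ) : ∀ᵐ p ∂(uniformSquare a D), p ∈ square a D :=
  ProbabilityTheory.ae_cond_mem (measurableSet_square a D)

/-- The wave kernel on the plane. -/
noncomputable def planeWave (L κ : ℝ) (p q : Plane) : ℂ := wave L κ (p 0 - q 0) (p 1 - q 1)

theorem planeWave_swap (L κ : ℝ) (p q : Plane) : planeWave L κ p q = planeWave L κ q p := by
  rw [planeWave, planeWave, ← wave_neg, neg_sub, neg_sub]

theorem norm_planeWave_le {L : ℝ} (hL : 0 < L) (κ : ℝ) (p q : Plane) : ‖planeWave L κ p q‖ ≤ 2 :=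
  norm_wave_le hL _ _ _

theorem continuous_planeWave {L : ℝ} (hL : 0 < L) (κ : ℝ) :
    Continuous fun x : Plane × Plane => planeWave L κ x.1 x.2 := by
  have h : Continuous fun x : Plane × Plane => (x.1 0 - x.2 0, x.1 1 - x.2 1) := by fun_prop
  have h2 := (continuous_wave hL κ).comp h
  exact h2

/-- The truncation is inactive at distances of at least `L / 2`, hence for all points of the two
squares. It serves only to make the kernel bounded and continuous on the whole plane. -/
theorem planeWave_eq (L κ : ℝ) (p q : Plane) (h : L / 2 ≤ dist p q) :
    planeWave L κ p q = ((L / dist p q : ℝ) : ℂ) *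
      Complex.exp (-Complex.I * ((κ * dist p q : ℝ) : ℂ)) := by
  have e : √((p 0 - q 0) ^ 2 + (p 1 - q 1) ^ 2) = dist p q := by
    rw [EuclideanSpace.dist_eq, Fin.sum_univ_two, Real.dist_eq, Real.dist_eq, sq_abs, sq_abs]
  rw [planeWave, wave, e, max_eq_left h]

theorem planeWave_planeEquiv (L κ a b u v : ℝ) :
    planeWave L κ (planeEquiv (a, b)) (planeEquiv (u, v)) = wave L κ (a - u) (b - v) := rfl

attribute [irreducible] planeWave

/-- The operator bound for the wave kernel between two squares. -/
theorem integral_norm_sq_integral_planeWave_le {L κ D β a₁ a₂ : ℝ} (hL : 0 < L) (hκ : 0 < κ)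
    (hD : 0 < D) (hβ : 0 < β)
    (hsep : ∀ x ∈ Set.Icc a₁ (a₁ + D), ∀ y ∈ Set.Icc a₂ (a₂ + D), L / 2 ≤ |x - y| ∧ D ≤ |x - y|)
    (hβL : 6 * L ≤ κ * β * D) {g : Plane → ℂ} (hg : Measurable g) (hgb : ∀ v, ‖g v‖ ≤ 2) :
    ∫ p, ‖∫ q, g q * planeWave L κ p q ∂(uniformSquare a₂ D)‖ ^ 2 ∂(uniformSquare a₁ D) ≤
      64 * (β / D) * Real.log (1 + D / β) := by
  have := isProbabilityMeasure_uniformIcc 0 hD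
  have := isProbabilityMeasure_uniformIcc a₁ hD
  have := isProbabilityMeasure_uniformIcc a₂ hD
  simp_rw [integral_uniformSquare hD]
  have hlog : 0 ≤ Real.log (1 + D / β) := Real.log_nonneg (by
    have : 0 ≤ D / β := by positivity
    linarith)
  have hwm : Measurable fun x : Plane × Plane => g x.2 * planeWave L κ x.1 x.2 :=
    (hg.comp measurable_snd).mul (continuous_planeWave hL κ).measurable
  have hf : Measurable fun x : (ℝ × ℝ) × (ℝ × ℝ) => g (planeEquiv x.2) *
      planeWave L κ (planeEquiv x.1) (planeEquiv x.2) :=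
    hwm.comp ((planeEquiv.measurable.comp measurable_fst).prodMk
      (planeEquiv.measurable.comp measurable_snd))
  have hb : ∀ p q : Plane, ‖g q * planeWave L κ p q‖ ≤ 4 := fun p q => by
    rw [norm_mul]
    nlinarith [hgb q, norm_planeWave_le hL κ p q, norm_nonneg (g q),
      norm_nonneg (planeWave L κ p q)]
  let F : ℝ → ℝ → ℝ → ℂ := fun a b u => ∫ v, g (planeEquiv (u, v)) *
    planeWave L κ (planeEquiv (a, b)) (planeEquiv (u, v)) ∂(uniformIcc 0 D)
  have hFm : Measurable fun x : (ℝ × ℝ) × ℝ => F x.1.1 x.1.2 x.2 := by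
    have : Measurable fun y : ((ℝ × ℝ) × ℝ) × ℝ => g (planeEquiv (y.1.2, y.2)) *
      planeWave L κ (planeEquiv (y.1.1.1, y.1.1.2)) (planeEquiv (y.1.2, y.2)) :=
      hf.comp (by fun_prop : Measurable fun y : ((ℝ × ℝ) × ℝ) × ℝ =>
        ((y.1.1.1, y.1.1.2), (y.1.2, y.2)))
    exact (this.stronglyMeasurable.integral_prod_right' (ν := uniformIcc 0 D)).measurable
  have hFb : ∀ a b u, ‖F a b u‖ ≤ 4 := fun a b u => by
    refine (norm_integral_le_of_norm_le_const (C := 4) (ae_of_all _ fun v => hb _ _)).trans ?_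
    simp
  have hF2 : ∀ a b u, ‖‖F a b u‖ ^ 2‖ ≤ 16 := fun a b u => by
    rw [norm_pow, norm_norm]
    nlinarith [hFb a b u, norm_nonneg (F a b u)]
  have hFi : Integrable (fun x : (ℝ × ℝ) × ℝ => ‖F x.1.1 x.1.2 x.2‖ ^ 2)
      (((uniformIcc a₁ D).prod (uniformIcc 0 D)).prod (uniformIcc a₂ D)) :=
    integrable_of_bounded (hFm.norm.pow_const 2) fun x => hF2 _ _ _
  -- Jensen in the horizontal source coordinate `u` reduces to frozen horizontal coordinates; only
  -- oscillation in the vertical direction is exploited.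
  have hjensen : ∀ p : ℝ × ℝ, ‖∫ q, g (planeEquiv q) *
      planeWave L κ (planeEquiv p) (planeEquiv q) ∂((uniformIcc a₂ D).prod (uniformIcc 0 D))‖ ^ 2 ≤
      ∫ u, ‖F p.1 p.2 u‖ ^ 2 ∂(uniformIcc a₂ D) := by
    intro p
    have hi : Integrable (fun q => g (planeEquiv q) * planeWave L κ (planeEquiv p) (planeEquiv q))
        ((uniformIcc a₂ D).prod (uniformIcc 0 D)) :=
      integrable_of_bounded (hf.comp (by fun_prop : Measurable fun q : ℝ × ℝ => (p, q)))
        fun q => hb _ _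
    rw [integral_prod _ hi]
    have hm : Measurable fun u => ‖F p.1 p.2 u‖ :=
      (hFm.comp (by fun_prop : Measurable fun u : ℝ => ((p.1, p.2), u))).norm
    calc _ ≤ (∫ u, ‖F p.1 p.2 u‖ ∂(uniformIcc a₂ D)) ^ 2 := by
          gcongr
          exact norm_integral_le_integral_norm _
      _ ≤ _ := sq_integral_le_integral_sq _ hm (B := 4) fun u => by
          rw [abs_norm]; exact hFb _ _ _
  refine (integral_mono_of_nonneg (ae_of_all _ fun p => sq_nonneg _) hFi.integral_prod_left
    (ae_of_all _ hjensen)).trans ?_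
  rw [integral_prod _ hFi.integral_prod_left]
  have hin : ∀ a ∈ Set.Icc a₁ (a₁ + D), ∫ b, ∫ u, ‖F a b u‖ ^ 2 ∂(uniformIcc a₂ D)
      ∂(uniformIcc 0 D) ≤ 64 * (β / D) * Real.log (1 + D / β) := by
    intro a ha
    rw [integral_integral_swap (f := fun b u => ‖F a b u‖ ^ 2)
      (integrable_of_bounded ((hFm.comp (by fun_prop : Measurable fun x : ℝ × ℝ =>
        ((a, x.1), x.2))).norm.pow_const 2) fun x => hF2 _ _ _)]
    refine (integral_mono_of_nonneg (ae_of_all _ fun u => integral_nonneg fun b => sq_nonneg _)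
      (integrable_const (64 * (β / D) * Real.log (1 + D / β)))
      ((ae_uniformIcc_mem a₂ D).mono fun u hu => ?_)).trans (by simp)
    obtain ⟨h1, h2⟩ := hsep a ha u hu
    simp only [F, planeWave_planeEquiv]
    exact integral_norm_sq_integral_wave_le hL hκ hD hβ h1 h2 hβL
      (g := fun v => g (planeEquiv (u, v))) (hg.comp (planeEquiv.measurable.comp (by fun_prop)))
      fun v => hgb _
  refine (integral_mono_of_nonneg (ae_of_all _ fun a => integral_nonneg fun b =>
    integral_nonneg fun u => sq_nonneg _)
    (integrable_const (64 * (β / D) * Real.log (1 + D / β)))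
    ((ae_uniformIcc_mem a₁ D).mono hin)).trans (by simp)

/-! ### Assembly of the capacity bound -/

/-- As `D ≤ L / 2`, the horizontal offset lies between `L / 2` and `3 L / 2` and the vertical one is
at most `L / 2`, whence `9/4 + 1/4 = 5/2`. -/
theorem dist_bounds_of_mem_square {D L : ℝ} (hD : 0 < D) (hL : 2 * D ≤ L) {t r : Plane}
    (ht : t ∈ square 0 D) (hr : r ∈ square L D) :
    L / 2 ≤ dist r t ∧ dist r t ^ 2 ≤ 5 / 2 * L ^ 2 := by
  obtain ⟨⟨h1, h2⟩, h3, h4⟩ := ht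
  obtain ⟨⟨h5, h6⟩, h7, h8⟩ := hr
  have e : dist r t = √((r 0 - t 0) ^ 2 + (r 1 - t 1) ^ 2) := by
    rw [EuclideanSpace.dist_eq, Fin.sum_univ_two, Real.dist_eq, Real.dist_eq, sq_abs, sq_abs]
  rw [e, Real.sq_sqrt (by positivity)]
  constructor
  · apply Real.le_sqrt_of_sq_le
    nlinarith [sq_nonneg (r 1 - t 1)]
  · have h9 : (r 0 - t 0) ^ 2 ≤ (L + D) ^ 2 := by
      apply sq_le_sq' <;> linarith
    have h10 : (r 1 - t 1) ^ 2 ≤ D ^ 2 := by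
      apply sq_le_sq' <;> linarith
    nlinarith

/-- Matches the operator bound with `dof`. Against 1 use `log (1 + x) ≤ x`; against the second entry
use `log (1 + x) ≤ 1` for `x ≤ 1` and `log (1 + x) ≤ log 2 + log x ≤ 1 + log₂ x` for `x ≥ 1`. -/
theorem log_one_add_div_le_dof {x : ℝ} (hx : 0 < x) :
    Real.log (1 + x) / x * max 1 (x / (1 + max (Real.logb 2 x) 0)) ≤ 1 := by
  have hlog : 0 ≤ Real.log (1 + x) := Real.log_nonneg (by linarith)
  have hle : Real.log (1 + x) ≤ x := by linarith [Real.log_le_sub_one_of_pos (by linarith : 0 < 1 + x)]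
  have hden : 0 < 1 + max (Real.logb 2 x) 0 := by
    linarith [le_max_right (Real.logb 2 x) 0]
  rcases max_choice 1 (x / (1 + max (Real.logb 2 x) 0)) with h | h <;> rw [h]
  · rw [mul_one, div_le_one hx]; exact hle
  · rw [div_mul_div_comm, mul_comm x, mul_div_mul_right _ _ hx.ne', div_le_one hden]
    have hl2 : Real.log 2 ≤ 1 := by linarith [Real.log_two_lt_d9]
    have hl2' : 0 < Real.log 2 := Real.log_pos (by norm_num)
    rcases le_total x 1 with h1 | h1
    · linarith [le_max_right (Real.logb 2 x) 0]
    · have h2 : Real.log (1 + x) ≤ Real.log 2 + Real.log x := by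
        rw [← Real.log_mul (by norm_num) (by linarith)]
        exact Real.log_le_log (by linarith) (by linarith)
      have h3 : Real.log x ≤ Real.logb 2 x := by
        rw [Real.logb, le_div_iff₀ hl2']
        nlinarith [Real.log_nonneg h1]
      linarith [le_max_left (Real.logb 2 x) 0]

/-- The deterministic capacity bound in terms of the normalized fourth moment. -/
theorem le_capacity_of_sum_colCorrSq_le {N : ℕ} (hN : 0 < N) {D L lam G P B m : ℝ} (hD : 0 < D)
    (hL : 2 * D ≤ L) (hG : 0 < G) (hP : 0 < P) (hB : 0 < B) (hm : 0 < m)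
    {t r : Fin N → Plane} (ht : ∀ k, t k ∈ square 0 D) (hr : ∀ i, r i ∈ square L D)
    (hT : ∑ k, ∑ k', colCorrSq (planeWave L (2 * Real.pi / lam)) r (t k) (t k') ≤
      B * N ^ 4 / m) :
    ENNReal.ofReal (1 / (25 * B) * m * Real.logb 2 (1 + 1 / 5 * (G * P / L ^ 2) * N)) ≤
      capacity P (channelMatrix G lam t r) := by
  have hN' : (0 : ℝ) < N := by exact_mod_cast hN
  have hLpos : 0 < L := by linarith
  have hd := fun i k => dist_bounds_of_mem_square hD hL (ht k) (hr i)
  set H := channelMatrix G lam t r with hH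
  have hHe : ∀ i k, H i k = ((√G / L : ℝ) : ℂ) *
      planeWave L (2 * Real.pi / lam) (r i) (t k) := by
    intro i k
    rw [planeWave_eq _ _ _ _ (hd i k).1, hH, channelMatrix, Matrix.of_apply, ← mul_assoc,
      ← Complex.ofReal_mul, div_mul_div_cancel₀ hLpos.ne']
  have hHn : ∀ i k, G / L ^ 2 * (2 / 5) ≤ ‖H i k‖ ^ 2 := by
    intro i k
    have hdpos : 0 < dist (r i) (t k) := lt_of_lt_of_le (by positivity) (hd i k).1
    have : ‖H i k‖ = √G / dist (r i) (t k) := by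
      rw [hH, channelMatrix, Matrix.of_apply, norm_mul, Complex.norm_exp, Complex.norm_real,
        Real.norm_eq_abs, abs_of_nonneg (by positivity)]
      simp
    rw [this, div_pow, Real.sq_sqrt hG.le, div_mul_eq_mul_div, div_le_div_iff₀ (by positivity)
      (by positivity)]
    have := (hd i k).2
    nlinarith
  have htr : G / L ^ 2 * (2 / 5) * N ^ 2 ≤ ∑ i, ∑ k, ‖H i k‖ ^ 2 := by
    calc G / L ^ 2 * (2 / 5) * N ^ 2 = ∑ _i : Fin N, ∑ _k : Fin N, G / L ^ 2 * (2 / 5) := by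
          simp; ring
      _ ≤ _ := Finset.sum_le_sum fun i _ => Finset.sum_le_sum fun k _ => hHn i k
  have htr2 : ∑ k, ∑ k', ‖∑ i, H i k * (starRingEnd ℂ) (H i k')‖ ^ 2 ≤
      (G / L ^ 2) ^ 2 * (B * N ^ 4 / m) := by
    have e : ∀ k k', ‖∑ i, H i k * (starRingEnd ℂ) (H i k')‖ ^ 2 = (G / L ^ 2) ^ 2 *
        colCorrSq (planeWave L (2 * Real.pi / lam)) r (t k) (t k') := by
      intro k k'
      have : ∑ i, H i k * (starRingEnd ℂ) (H i k') = ((G / L ^ 2 : ℝ) : ℂ) *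
          ∑ i, planeWave L (2 * Real.pi / lam) (r i) (t k) *
            (starRingEnd ℂ) (planeWave L (2 * Real.pi / lam) (r i) (t k')) := by
        rw [Finset.mul_sum]
        refine Finset.sum_congr rfl fun i _ => ?_
        have e2 : (G / L ^ 2 : ℝ) = (√G / L) * (√G / L) := by
          rw [div_mul_div_comm, Real.mul_self_sqrt hG.le, pow_two]
        rw [hHe, hHe, map_mul, Complex.conj_ofReal, e2, Complex.ofReal_mul]
        ring
      rw [this, norm_mul, mul_pow, Complex.norm_real, Real.norm_eq_abs, sq_abs, colCorrSq]
    simp_rw [e, ← Finset.mul_sum]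
    gcongr
  have hpos : 0 < G / L ^ 2 * (2 / 5) * N ^ 2 := by positivity
  refine le_trans (ENNReal.ofReal_le_ofReal ?_)
    (trace_bound_le_capacity hN hP H (hpos.trans_le htr))
  set tr := ∑ i, ∑ k, ‖H i k‖ ^ 2
  set tr2 := ∑ k, ∑ k', ‖∑ i, H i k * (starRingEnd ℂ) (H i k')‖ ^ 2
  have htr2pos : 0 < tr2 := by
    have hk : Nonempty (Fin N) := ⟨⟨0, hN⟩⟩
    have hnn : 0 ≤ tr2 := Finset.sum_nonneg fun _ _ => Finset.sum_nonneg fun _ _ => sq_nonneg _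
    refine hnn.lt_of_ne fun h0 => ?_
    have h1 := (Finset.sum_eq_zero_iff_of_nonneg fun k _ => Finset.sum_nonneg
      fun k' _ => sq_nonneg ‖∑ i, H i k * (starRingEnd ℂ) (H i k')‖).1 h0.symm ⟨0, hN⟩
      (Finset.mem_univ _)
    have h2 := (Finset.sum_eq_zero_iff_of_nonneg fun k' _ =>
      sq_nonneg ‖∑ i, H i ⟨0, hN⟩ * (starRingEnd ℂ) (H i k')‖).1 h1 ⟨0, hN⟩ (Finset.mem_univ _)
    have h3 : ∑ i, H i ⟨0, hN⟩ * (starRingEnd ℂ) (H i ⟨0, hN⟩) = 0 := by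
      simpa using h2
    have h4 : ∑ i, ‖H i ⟨0, hN⟩‖ ^ 2 = 0 := by
      simp only [Complex.mul_conj, Complex.normSq_eq_norm_sq] at h3
      exact_mod_cast h3
    have h5 := (Finset.sum_eq_zero_iff_of_nonneg fun i _ => sq_nonneg ‖H i ⟨0, hN⟩‖).1 h4 ⟨0, hN⟩
      (Finset.mem_univ _)
    have h6 := hHn ⟨0, hN⟩ ⟨0, hN⟩
    have : 0 < G / L ^ 2 * (2 / 5) := by positivity
    linarith
  -- The trace is at least `2/5` of `G N² / L²`; its square `4/25` against the factor 4 leaves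
  -- `1/25`.
  have hcoef : 1 / (25 * B) * m ≤ tr ^ 2 / (4 * tr2) := by
    rw [le_div_iff₀ (by positivity)]
    calc 1 / (25 * B) * m * (4 * tr2) ≤
        1 / (25 * B) * m * (4 * ((G / L ^ 2) ^ 2 * (B * N ^ 4 / m))) := by gcongr
      _ = (G / L ^ 2 * (2 / 5) * N ^ 2) ^ 2 := by field_simp; norm_num
      _ ≤ tr ^ 2 := by gcongr
  have hlog : 0 ≤ Real.logb 2 (1 + 1 / 5 * (G * P / L ^ 2) * N) :=
    Real.logb_nonneg (by norm_num) (by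
      have : 0 ≤ 1 / 5 * (G * P / L ^ 2) * N := by positivity
      linarith)
  have hlog2 : Real.logb 2 (1 + 1 / 5 * (G * P / L ^ 2) * N) ≤
      Real.logb 2 (1 + P * (tr / (2 * N))) := by
    apply Real.logb_le_logb_of_le (by norm_num) (by positivity)
    refine add_le_add le_rfl ?_
    calc 1 / 5 * (G * P / L ^ 2) * N = P * ((G / L ^ 2 * (2 / 5) * N ^ 2) / (2 * N)) := by
          field_simp
      _ ≤ P * (tr / (2 * N)) := by gcongr
  exact mul_le_mul hcoef hlog2 hlog (by positivity)

/-- The high-probability capacity bound at a fixed number of nodes. -/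
theorem nodeLaw_capacity_lt_le {N : ℕ} (hN : 0 < N) {D L lam G P : ℝ} (hD : 0 < D)
    (hL : 2 * D ≤ L) (hlam : 0 < lam) (hG : 0 < G) (hP : 0 < P) :
    nodeLaw N D L {tr | ¬ ENNReal.ofReal (1 / (25 * 2210) * min (N : ℝ) (dof D L lam) *
        Real.logb 2 (1 + 1 / 5 * (G * P / L ^ 2) * N)) ≤
      capacity P (channelMatrix G lam tr.1 tr.2)} ≤ ENNReal.ofReal (3604 / N) := by
  have hN' : (0 : ℝ) < N := by exact_mod_cast hN
  have hLpos : 0 < L := by linarith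
  have := isProbabilityMeasure_uniformSquare hD 0
  have := isProbabilityMeasure_uniformSquare hD L
  set κ := 2 * Real.pi / lam with hκdef
  have hκ : 0 < κ := by positivity
  -- The transverse distance beyond which two waves decorrelate. It makes `D / β = D² / (λ L)`, and
  -- `κ β D = 2 π L` exceeds `6 L`.
  set β := lam * L / D with hβdef
  have hβ : 0 < β := by positivity
  have hβL : 6 * L ≤ κ * β * D := by
    have : κ * β * D = 2 * Real.pi * L := by
      rw [hκdef, hβdef]; field_simp
    rw [this]
    nlinarith [Real.pi_gt_three]
  set ε := 64 * (β / D) * Real.log (1 + D / β) with hεdef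
  have hx : 0 < D / β := by positivity
  have hε : 0 ≤ ε := by
    have : 0 ≤ Real.log (1 + D / β) := Real.log_nonneg (by linarith)
    positivity
  have hm : Measurable (Function.uncurry (planeWave L κ)) := (continuous_planeWave hLpos κ).measurable
  have hb := norm_planeWave_le hLpos κ
  have hcol : ∀ t : Plane, ∫ t', ‖∫ r, planeWave L κ r t *
      (starRingEnd ℂ) (planeWave L κ r t') ∂(uniformSquare L D)‖ ^ 2 ∂(uniformSquare 0 D) ≤ ε := by
    intro t
    have h := integral_norm_sq_integral_planeWave_le (a₁ := 0) (a₂ := L) hLpos hκ hD hβ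
      (fun x hx y hy => by
        rw [abs_sub_comm, abs_of_nonneg] <;> [constructor; skip] <;>
        linarith [hx.1, hx.2, hy.1, hy.2]) hβL
      (g := fun r => (starRingEnd ℂ) (planeWave L κ r t))
      (Complex.continuous_conj.measurable.comp (hm.comp (by fun_prop :
        Measurable fun r : Plane => (r, t)))) (fun r => by rw [RCLike.norm_conj]; exact hb r t)
    refine Eq.trans_le (integral_congr_ae (ae_of_all _ fun t' => ?_)) h
    simp only
    rw [← RCLike.norm_conj, ← integral_conj]
    simp only [map_mul, Complex.conj_conj, planeWave_swap L κ t']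
  have hrow : ∀ r : Plane, ∫ r', ‖∫ t, planeWave L κ r t *
      (starRingEnd ℂ) (planeWave L κ r' t) ∂(uniformSquare 0 D)‖ ^ 2 ∂(uniformSquare L D) ≤ ε := by
    intro r
    have h := integral_norm_sq_integral_planeWave_le (a₁ := L) (a₂ := 0) hLpos hκ hD hβ
      (fun x hx y hy => by
        rw [abs_of_nonneg] <;> [constructor; skip] <;>
        linarith [hx.1, hx.2, hy.1, hy.2]) hβL
      (g := fun t => (starRingEnd ℂ) (planeWave L κ r t))
      (Complex.continuous_conj.measurable.comp (hm.comp (by fun_prop :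
        Measurable fun t : Plane => (r, t)))) (fun t => by rw [RCLike.norm_conj]; exact hb r t)
    refine Eq.trans_le (integral_congr_ae (ae_of_all _ fun r' => ?_)) h
    simp only
    rw [← RCLike.norm_conj, ← integral_conj]
    simp only [map_mul, Complex.conj_conj]
  have htail := real_sum_colCorrSq_gt_le (μ := uniformSquare 0 D) (ν := uniformSquare L D)
    hN hm hb hε hcol hrow
  set m := min (N : ℝ) (dof D L lam) with hmdef
  have hdof : 1 ≤ dof D L lam := le_max_left _ _
  have hmpos : 0 < m := lt_min hN' (by linarith)
  have hεm : ε * m ≤ 64 := by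
    have h1 := log_one_add_div_le_dof hx
    have e : D / β = D ^ 2 / (lam * L) := by rw [hβdef]; field_simp
    have e2 : ε = 64 * (Real.log (1 + D / β) / (D / β)) := by
      rw [hεdef]; field_simp
    have h2 : Real.log (1 + D / β) / (D / β) * dof D L lam ≤ 1 := by
      rw [dof, ← e]; exact h1
    have h3 : 0 ≤ Real.log (1 + D / β) / (D / β) := by
      have := Real.log_nonneg (by linarith : 1 ≤ 1 + D / β)
      positivity
    calc ε * m ≤ ε * dof D L lam := by gcongr; exact min_le_right _ _
      _ = 64 * (Real.log (1 + D / β) / (D / β) * dof D L lam) := by rw [e2]; ring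
      _ ≤ 64 := by linarith
  -- From `m ≤ N` and `ε m ≤ 64`: the constant is `34 · (1 + 64) = 2210`.
  have hthr : 34 * (N : ℝ) ^ 2 * (N + N ^ 2 * ε) ≤ 2210 * N ^ 4 / m := by
    rw [le_div_iff₀ hmpos]
    have h1 : (N : ℝ) ^ 3 * m ≤ N ^ 3 * N := by gcongr; exact min_le_left _ _
    have h2 : (N : ℝ) ^ 4 * (ε * m) ≤ N ^ 4 * 64 := by gcongr
    nlinarith
  have hae : ∀ᵐ tr ∂(nodeLaw N D L), (∀ k, tr.1 k ∈ square 0 D) ∧ ∀ i, tr.2 i ∈ square L D := by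
    have h1 : ∀ᵐ t ∂(Measure.pi fun _ : Fin N => uniformSquare 0 D), ∀ k, t k ∈ square 0 D :=
      ae_all_iff.2 fun k => (measurePreserving_eval (fun _ : Fin N => uniformSquare 0 D)
        k).quasiMeasurePreserving.ae (ae_uniformSquare_mem 0 D)
    have h2 : ∀ᵐ r ∂(Measure.pi fun _ : Fin N => uniformSquare L D), ∀ k, r k ∈ square L D :=
      ae_all_iff.2 fun k => (measurePreserving_eval (fun _ : Fin N => uniformSquare L D)
        k).quasiMeasurePreserving.ae (ae_uniformSquare_mem L D)
    exact (Measure.quasiMeasurePreserving_fst.ae h1).and (Measure.quasiMeasurePreserving_snd.ae h2)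
  calc nodeLaw N D L _ ≤ nodeLaw N D L {p | 34 * (N : ℝ) ^ 2 * (N + N ^ 2 * ε) <
        ∑ k, ∑ k', colCorrSq (planeWave L κ) p.2 (p.1 k) (p.1 k')} := by
        -- Inclusion up to the null set of positions outside the squares is enough, and the capacity
        -- event need not be measurable.
        refine measure_mono_ae (hae.mono fun tr htr hbad => ?_)
        by_contra hcon
        refine hbad (le_capacity_of_sum_colCorrSq_le hN hD hL hG hP (by norm_num) hmpos htr.1 htr.2
          ((not_lt.1 hcon).trans hthr))
    _ ≤ ENNReal.ofReal (3604 / N) := by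
        rw [nodeLaw, ← ofReal_measureReal]
        exact ENNReal.ofReal_le_ofReal htail

end ClusterMIMO

theorem corollary1 :
    ∃ K₃ K₄ : ℝ, 0 < K₃ ∧ 0 < K₄ ∧
      ∀ D L lam G P : ℕ → ℝ,
        (∀ N, 0 < D N) → (∀ N, 2 * D N ≤ L N) → (∀ N, 0 < lam N) →
        (∀ N, 0 < G N) → (∀ N, 0 < P N) →
        Tendsto
          (fun N : ℕ => ClusterMIMO.nodeLaw N (D N) (L N)
            {tr | ¬ ENNReal.ofReal
                  (K₃ * min (N : ℝ) (ClusterMIMO.dof (D N) (L N) (lam N)) *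
                    Real.logb 2 (1 + K₄ * (G N * P N / L N ^ 2) * N)) ≤
                ClusterMIMO.capacity (P N)
                  (ClusterMIMO.channelMatrix (G N) (lam N) tr.1 tr.2)})
          atTop (𝓝 0) := by
  refine ⟨1 / (25 * 2210), 1 / 5, by norm_num, by norm_num, fun D L lam G P hD hL hlam hG hP => ?_⟩
  -- The failure probability is at most `3604 / N` uniformly in all parameters, so their dependence
  -- on `N` is immaterial.
  have h0 : Tendsto (fun N : ℕ => ENNReal.ofReal (3604 / (N : ℝ))) atTop (𝓝 0) := by
    have := ENNReal.tendsto_ofReal (tendsto_const_div_atTop_nhds_zero_nat 3604)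
    rwa [ENNReal.ofReal_zero] at this
  refine tendsto_of_tendsto_of_tendsto_of_le_of_le' tendsto_const_nhds h0
    (Eventually.of_forall fun _ => zero_le) ((eventually_gt_atTop 0).mono fun N hN => ?_)
  exact ClusterMIMO.nodeLaw_capacity_lt_le hN (hD N) (hL N) (hlam N) (hG N) (hP N)
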